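/- Let $d\ge 2$, $\rho,\nu,r>0$, $N\in\{1,2,\dots\}$, and $\Lambda_N=(-L_N/2,L_N/2)^d$ with $L_N=\rho^{-1/d}N^{1/d}$. Let $(\Omega,\mathcal F,\mathbb P)$ be a probability space carrying a Poisson point process with locally finite point set $\{x_m^\omega\}_m\subset\mathbb R^d$ and constant intensity $\nu$. Let $\Lambda_N^\omega=\Lambda_N\setminus\bigcup_m \overline{B_r(x_m^\omega)}$ be the vacancy set. Let $v_N\in L^1(\mathbb R^d)\cap L^\infty(\mathbb R^d)$ be real-valued, nonnegative and even, with Fourier transform $\widehat v_N\ge 0$ and $\widehat v_N\in L^1(\mathbb R^d)$. Let $0<\eta<\mathrm e^{-\nu\omega_d r^d}$, where $\omega_d$ is the volume of the unit ball in $\mathbb R^d$. Let $e_N^{1,\omega}\le e_N^{2,\omega}$ be the two lowest eigenvalues, counted with multiplicity, of the Dirichlet Laplacian $-\Delta$ on $L^2(\Lambda_N^\omega)$ (form domain $H^1_0(\Lambda_N^\omega)$), and let $C_1=2(4\pi)^{-d/4}\mathrm e$. Let $\Omega_N^{(2),\eta}$ be the set of all $\omega\in\Omega$ with $$\Bigl|\tfrac{|\Lambda_N^\omega|}{|\Lambda_N|}-\mathrm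 e^{-\nu\omega_d r^d}\Bigr|<\eta\quad\text{and}\quad e_N^{2,\omega}-e_N^{1,\omega}>C_1^2N\|v_N\|_1\,(e_N^{1,\omega})^{d/2}.$$ Let $\omega\in\Omega_N^{(2),\eta}$. Let $\phi$ be a normalized eigenfunction of $-\Delta$ for $e_N^{1,\omega}$, let $K$ be the connected component of $\Lambda_N^\omega$ outside of which $\phi$ vanishes almost everywhere, and let $\widetilde u\in H^1_0(K)$, $\|\widetilde u\|_2=1$, be a minimizer of the Hartree functional $$\psi\mapsto\int_{K}|\nabla\psi|^2\,\mathrm dx+\frac{N-1}{2}\int_K\int_K v_N(x-y)|\psi(x)|^2|\psi(y)|^2\,\mathrm dx\,\mathrm dy$$ among all $\psi\in H_0^1(K)$ with $\|\psi\|_2=1$. Consider on $L^2(\Lambda_N^\omega)$, with form domain $H_0^1(\Lambda_N^\omega)$, the self-adjoint operator $$h_N^{\widetilde u,\omega}=-\Delta+(N-1)\bigl(|\widetilde u|^2*v_N\bigr)-\frac{N-1}{2}\int_{\Lambda_N^\omega}\int_{\Lambda_N^\omega}v_N(x-y)|\widetilde u(x)|^2|\widetilde u(y)|^2\,\mathrm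 dx\,\mathrm dy .$$ Then $-\Delta$ and $h_N^{\widetilde u,\omega}$ have lowest and second-lowest eigenvalues, counted with multiplicity, and those of $h_N^{\widetilde u,\omega}$, denoted $e_N^{1,\widetilde u,\omega}\le e_N^{2,\widetilde u,\omega}$, satisfy $$e_N^{2,\widetilde u,\omega}-e_N^{1,\widetilde u,\omega}\ \ge\ e_N^{2,\omega}-e_N^{1,\omega}-C_1^2N\|v_N\|_1\,(e_N^{1,\omega})^{d/2}.$$ -/

import Mathlib

open MeasureTheory ProbabilityTheory Set
open scoped ENNReal NNReal ComplexConjugate FourierTransform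

noncomputable section

namespace KacLuttinger

/-! ### The random vacancy set -/

/-- The Euclidean space `ℝ^d`. -/
abbrev Space (d : ℕ) : Type := EuclideanSpace ℝ (Fin d)

/-- `X` is a Poisson point process on `ℝ^d` of constant intensity `ν`, given as a random locally
finite set of points: the numbers of points in bounded Borel sets are random variables which are
Poisson distributed with mean `ν |B|`, and independent for pairwise disjoint sets. -/
structure IsPoissonPointProcess {d : ℕ} {Ω : Type*} [MeasurableSpace Ω] (P : Measure Ω)
    (X : Ω → Set (Space d)) (ν : ℝ) : Prop where
  locallyFinite : ∀ ω, ∀ B : Set (Space d), Bornology.IsBounded B → (X ω ∩ B).Finite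
  measurable_count : ∀ B : Set (Space d), MeasurableSet B → Bornology.IsBounded B →
    Measurable fun ω => (X ω ∩ B).ncard
  law_count : ∀ B : Set (Space d), MeasurableSet B → Bornology.IsBounded B →
    P.map (fun ω => (X ω ∩ B).ncard) = poissonMeasure (ν * (volume B).toReal).toNNReal
  indep_count : ∀ (m : ℕ) (B : Fin m → Set (Space d)),
    (∀ i, MeasurableSet (B i)) → (∀ i, Bornology.IsBounded (B i)) →
    (∀ i j, i ≠ j → Disjoint (B i) (B j)) →
    iIndepFun (fun (i : Fin m) (ω : Ω) => (X ω ∩ B i).ncard) P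

/-- The box `Λ_N = (-L_N/2, L_N/2)^d` with side length `L_N = ρ^{-1/d} N^{1/d}`. -/
def box (d : ℕ) (ρ : ℝ) (N : ℕ) : Set (Space d) :=
  {x | ∀ i, -(ρ ^ (-(1 : ℝ) / d) * (N : ℝ) ^ ((1 : ℝ) / d)) / 2 < x i ∧
    x i < (ρ ^ (-(1 : ℝ) / d) * (N : ℝ) ^ ((1 : ℝ) / d)) / 2}

/-- The vacancy set: the box without the closed balls of radius `r` around the points of `S`. -/
def vacancySet {d : ℕ} (ρ r : ℝ) (N : ℕ) (S : Set (Space d)) : Set (Space d) :=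
  box d ρ N \ ⋃ p ∈ S, Metric.closedBall p r

/-- `K` is a connected component of `U`. -/
def IsComponent {d : ℕ} (U K : Set (Space d)) : Prop :=
  ∃ x ∈ U, K = connectedComponentIn U x

/-- The limiting fraction `exp(-ν ω_d r^d)` of the vacancy set, `ω_d` being the volume of the unit
ball. -/
def vacancyFraction (d : ℕ) (ν r : ℝ) : ℝ :=
  Real.exp (-(ν * (volume (Metric.ball (0 : Space d) 1)).toReal * r ^ d))

/-! ### The Sobolev space `H^1_0` -/

/-- Complex-valued `L²(ℝ^d)`. -/
abbrev L2 (d : ℕ) : Type := Lp ℂ 2 (volume : Measure (Space d))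

/-- The Hilbert space of pairs `(ψ, g)` with `ψ ∈ L²(ℝ^d)` and `g ∈ L²(ℝ^d)^d`. An element of
`H^1(ℝ^d)` is identified with the pair of its function and its gradient, so that the norm
is the `H^1` norm. -/
abbrev Jet (d : ℕ) : Type := WithLp 2 (L2 d × PiLp 2 fun _ : Fin d => L2 d)

/-- Smooth complex-valued functions with compact support in `U`. -/
def IsTest {d : ℕ} (U : Set (Space d)) (f : Space d → ℂ) : Prop :=
  ContDiff ℝ ((⊤ : ℕ∞) : WithTop ℕ∞) f ∧ HasCompactSupport f ∧ tsupport f ⊆ U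

/-- The partial derivative `∂_i f`. -/
def partialDeriv {d : ℕ} (i : Fin d) (f : Space d → ℂ) (x : Space d) : ℂ :=
  fderiv ℝ f x (EuclideanSpace.single i 1)

/-- The subspace of all pairs `(f, ∇f)` with `f ∈ C_c^∞(U)`. -/
def testJets {d : ℕ} (U : Set (Space d)) : Submodule ℂ (Jet d) where
  carrier := {w | ∃ f : Space d → ℂ, IsTest U f ∧ w.fst =ᵐ[volume] f ∧
    ∀ i, w.snd i =ᵐ[volume] partialDeriv i f}
  zero_mem' := by
    refine ⟨fun _ => 0, ⟨contDiff_const, HasCompactSupport.zero, ?_⟩, ?_, fun i => ?_⟩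
    · have h : tsupport (fun _ : Space d => (0 : ℂ)) = ∅ := tsupport_eq_empty_iff.mpr rfl
      simp [h]
    · exact Lp.coeFn_zero ..
    · refine (Lp.coeFn_zero ℂ 2 (volume : Measure (Space d))).trans ?_
      refine Filter.Eventually.of_forall fun x => ?_
      simp [partialDeriv]
  add_mem' := by
    rintro a b ⟨f, ⟨hf, hfc, hfU⟩, haf, had⟩ ⟨g, ⟨hg, hgc, hgU⟩, hbg, hbd⟩
    refine ⟨f + g, ⟨hf.add hg, hfc.add hgc, (tsupport_add f g).trans (union_subset hfU hgU)⟩,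
      ?_, fun i => ?_⟩
    · exact (Lp.coeFn_add a.fst b.fst).trans (haf.add hbg)
    · refine (Lp.coeFn_add (a.snd i) (b.snd i)).trans (((had i).add (hbd i)).trans ?_)
      refine Filter.Eventually.of_forall fun x => ?_
      have h1 : DifferentiableAt ℝ f x := (hf.differentiable (by simp)) x
      have h2 : DifferentiableAt ℝ g x := (hg.differentiable (by simp)) x
      simp [partialDeriv, fderiv_add h1 h2]
  smul_mem' := by
    rintro c a ⟨f, ⟨hf, hfc, hfU⟩, haf, had⟩
    refine ⟨c • f, ⟨contDiff_const.smul hf, hfc.smul_left (f := fun _ => c),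
      (closure_mono (Function.support_const_smul_subset c f)).trans hfU⟩, ?_, fun i => ?_⟩
    · exact (Lp.coeFn_smul c a.fst).trans (haf.const_smul c)
    · refine (Lp.coeFn_smul c (a.snd i)).trans (((had i).const_smul c).trans ?_)
      refine Filter.Eventually.of_forall fun x => ?_
      have h1 : DifferentiableAt ℝ f x := (hf.differentiable (by simp)) x
      simp [partialDeriv, fderiv_const_smul h1]

/-- `H^1_0(U)`: the closure of `C_c^∞(U)` in `H^1`. Its elements are pairs `(ψ, ∇ψ)` of functions
on `ℝ^d` that vanish almost everywhere outside `U`. -/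
def H10 {d : ℕ} (U : Set (Space d)) : Submodule ℂ (Jet d) := (testJets U).topologicalClosure

/-! ### Schrödinger operators with Dirichlet boundary conditions and their eigenvalues -/

/-- The sesquilinear form `⟨ψ, (-Δ + W) χ⟩` of `-Δ + W`, antilinear in the first argument. -/
def schrodingerForm {d : ℕ} (W : Space d → ℝ) (ψ χ : Jet d) : ℂ :=
  (∑ i, ∫ x, conj (ψ.snd i x) * χ.snd i x) + ∫ x, (W x : ℂ) * (conj (ψ.fst x) * χ.fst x)

/-- `ψ` is an eigenfunction, with eigenvalue `μ`, of the operator `-Δ + W` in `L²(U)` that is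
defined by its quadratic form on the form domain `H^1_0(U)`. -/
def IsEigenfunction {d : ℕ} (U : Set (Space d)) (W : Space d → ℝ) (μ : ℝ) (ψ : Jet d) : Prop :=
  ψ ∈ H10 U ∧ ψ ≠ 0 ∧ ∀ χ ∈ H10 U,
    schrodingerForm W χ ψ = (μ : ℂ) * ∫ x, conj (χ.fst x) * ψ.fst x

/-- All real `t` such that `-Δ + W` in `L²(U)` has at least `k` eigenvalues in `(-∞, t]`, counted
with multiplicity. -/
def eigenvalueBounds {d : ℕ} (U : Set (Space d)) (W : Space d → ℝ) (k : ℕ) : Set ℝ :=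
  {t | ∃ ψ : Fin k → Jet d, LinearIndependent ℂ ψ ∧
    ∀ j, ∃ μ ≤ t, IsEigenfunction U W μ (ψ j)}

/-- The `k`-th lowest eigenvalue (`k = 1, 2, …`) of `-Δ + W` in `L²(U)`, counted with
multiplicity. -/
def eigenvalue {d : ℕ} (U : Set (Space d)) (W : Space d → ℝ) (k : ℕ) : ℝ :=
  sInf (eigenvalueBounds U W k)

/-- The `k`-th lowest eigenvalue does exist: some least `t` has at least `k` eigenvalues, counted
with multiplicity, below or at it. This `t` is then an eigenvalue, and it is `eigenvalue U W k`. -/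
def HasEigenvalue {d : ℕ} (U : Set (Space d)) (W : Space d → ℝ) (k : ℕ) : Prop :=
  IsLeast (eigenvalueBounds U W k) (eigenvalue U W k)

/-- The `k`-th lowest eigenvalue of the Dirichlet Laplacian `-Δ` in `L²(U)`. -/
def freeEigenvalue {d : ℕ} (U : Set (Space d)) (k : ℕ) : ℝ := eigenvalue U (fun _ => 0) k

/-- `ψ` is a normalized eigenfunction for the lowest eigenvalue of the Dirichlet Laplacian. -/
def IsFreeGroundState {d : ℕ} (U : Set (Space d)) (ψ : Jet d) : Prop :=
  IsEigenfunction U (fun _ => 0) (freeEigenvalue U 1) ψ ∧ ‖ψ.fst‖ = 1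

/-! ### The interaction -/

/-- The pair potential is a nonnegative, even function in `L^1 ∩ L^∞` with a nonnegative and
integrable Fourier transform. -/
structure IsPairPotential {d : ℕ} (v : Space d → ℝ) : Prop where
  memLp_one : MemLp v 1 volume
  memLp_top : MemLp v ∞ volume
  nonneg : ∀ x, 0 ≤ v x
  even : ∀ x, v (-x) = v x
  fourier_nonneg : ∀ ξ, (𝓕 (fun x => (v x : ℂ)) ξ).im = 0 ∧ 0 ≤ (𝓕 (fun x => (v x : ℂ)) ξ).re
  fourier_integrable : Integrable (𝓕 (fun x => (v x : ℂ))) volume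

/-- `∫_U ∫_U v(x - y) |u(x)|² |u(y)|² dx dy`. -/
def selfEnergy {d : ℕ} (U : Set (Space d)) (v : Space d → ℝ) (u : Jet d) : ℝ :=
  ∫ x in U, ∫ y in U, v (x - y) * ‖u.fst x‖ ^ 2 * ‖u.fst y‖ ^ 2

/-- The Hartree functional on `K`. -/
def hartree {d : ℕ} (K : Set (Space d)) (v : Space d → ℝ) (N : ℕ) (u : Jet d) : ℝ :=
  (∫ x in K, ∑ i, ‖u.snd i x‖ ^ 2) + ((N : ℝ) - 1) / 2 * selfEnergy K v u

/-- `u` is a normalized minimizer of the Hartree functional on `H^1_0(K)`. -/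
def IsHartreeMinimizer {d : ℕ} (K : Set (Space d)) (v : Space d → ℝ) (N : ℕ) (u : Jet d) : Prop :=
  u ∈ H10 K ∧ ‖u.fst‖ = 1 ∧ ∀ w ∈ H10 K, ‖w.fst‖ = 1 → hartree K v N u ≤ hartree K v N w

/-- The mean-field potential
`(N-1) (|u|² * v) - (N-1)/2 ∫_U ∫_U v(x - y) |u(x)|² |u(y)|² dx dy`, so that the operator
`h_N^u` is `-Δ + meanField U v N u` in `L²(U)` with form domain `H^1_0(U)`. -/
def meanField {d : ℕ} (U : Set (Space d)) (v : Space d → ℝ) (N : ℕ) (u : Jet d)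
    (x : Space d) : ℝ :=
  ((N : ℝ) - 1) * (∫ y, ‖u.fst y‖ ^ 2 * v (x - y)) - ((N : ℝ) - 1) / 2 * selfEnergy U v u

/-- The constant `C₁ = 2 (4π)^{-d/4} e`. -/
def C₁ (d : ℕ) : ℝ := 2 * (4 * Real.pi) ^ (-(d : ℝ) / 4) * Real.exp 1

/-- The interaction term `C₁² N ‖v‖₁ (e¹)^{d/2}`. -/
def interactionTerm {d : ℕ} (U : Set (Space d)) (v : Space d → ℝ) (N : ℕ) : ℝ :=
  C₁ d ^ 2 * N * (∫ x, ‖v x‖) * freeEigenvalue U 1 ^ ((d : ℝ) / 2)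

/-! ### The events -/

/-- The event `Ω_N^{(1),η}`. -/
def eventOne {d : ℕ} {Ω : Type*} (X : Ω → Set (Space d)) (ρ ν r : ℝ) (N : ℕ) (η : ℝ) : Set Ω :=
  {ω | |(volume (vacancySet ρ r N (X ω))).toReal / (volume (box d ρ N)).toReal -
    vacancyFraction d ν r| < η}

/-- The event `Ω_N^{(2),η}`. -/
def eventTwo {d : ℕ} {Ω : Type*} (X : Ω → Set (Space d)) (ρ ν r : ℝ) (v : Space d → ℝ) (N : ℕ)
    (η : ℝ) : Set Ω :=
  {ω | ω ∈ eventOne X ρ ν r N η ∧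
    freeEigenvalue (vacancySet ρ r N (X ω)) 2 - freeEigenvalue (vacancySet ρ r N (X ω)) 1 >
      interactionTerm (vacancySet ρ r N (X ω)) v N}

end KacLuttinger

end

open KacLuttinger

noncomputable section

namespace KacLuttinger

/-! ### Eigenvalues of a form with compact embedding -/

section Abstract

open Filter Topology

variable {E F : Type*} [NormedAddCommGroup E] [InnerProductSpace ℂ E]
  [NormedAddCommGroup F] [InnerProductSpace ℂ F]

/-! Write $W=(N-1)(|\widetilde u|^2*v_N)\ge 0$ and let $c$ be the subtracted constant, so that the
operator is $-\Delta+W-c$. The constant cancels in the gap. Since $W\ge 0$, the second eigenvalue is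
at least $e^2-c$. With $\phi$ as trial function, the first is at most $e^1-c+\int W|\phi|^2$. So the
gap shrinks by at most $\int W|\phi|^2\le (N-1)\|v_N\|_1\|\phi\|_\infty^2$, because $|\widetilde
u|^2*v_N$ has integral $\|v_N\|_1$. These two steps are `gap_comparison` and
`integral_density_mul_le`.

It remains to see that $\|\phi\|_\infty^2\le \mathrm e\,(e^1/4\pi)^{d/2}$, which is
`ae_norm_sq_le_of_isEigenfunction`. Heuristically $|\phi|\le \mathrm e^{te^1}\mathrm
e^{t\Delta}|\phi|$ with the heat semigroup of the whole space, and one takes $t=1/(2e^1)$. No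
semigroup is built: `kato_inequality` gives $-\Delta|\phi|\le e^1|\phi|$ weakly on $\mathbb R^d$,
tested with Gaussians. It follows in `antitoneOn_gauss_mean` that $\mathrm e^{te^1}$ times the
Gaussian mean of $|\phi|$ at time $t$ increases with $t$. `ae_le_of_gauss_mean_le` lets $t\to 0$ and
recovers $|\phi|$ almost everywhere.

Eigenvalues are defined as infima of sets of bounds, so their existence needs proof.
`exists_isLowestPair` gets the first two by constrained minimisation from coercivity and a compact
embedding; `compactOn_H10` supplies the latter, a Rellich theorem proved by Fourier transform. -/

/-- The quadratic form of an operator. -/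
def quad (A : E →L[ℂ] E) (ψ : E) : ℝ := (inner ℂ ψ (A ψ)).re

lemma quad_sub_add_quad_add (A : E →L[ℂ] E) (x y : E) :
    quad A (x - y) + quad A (x + y) = 2 * quad A x + 2 * quad A y := by
  simp only [quad, map_add, map_sub, inner_add_left, inner_add_right, inner_sub_left,
    inner_sub_right, Complex.add_re, Complex.sub_re]
  ring

lemma quad_smul (A : E →L[ℂ] E) (c : ℂ) (x : E) : quad A (c • x) = ‖c‖ ^ 2 * quad A x := by
  simp only [quad, map_smul, inner_smul_left, inner_smul_right, ← mul_assoc]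
  rw [Complex.mul_conj, Complex.normSq_eq_norm_sq,
    Complex.re_ofReal_mul]

lemma continuous_quad (A : E →L[ℂ] E) : Continuous (quad A) := by
  unfold quad
  fun_prop

/-- Bounded sequences in `V` have subsequences whose image under `J` is Cauchy. -/
def CompactOn (V : Submodule ℂ E) (J : E →L[ℂ] F) : Prop :=
  ∀ x : ℕ → E, (∀ n, x n ∈ V) → (∃ R, ∀ n, ‖x n‖ ≤ R) →
    ∃ φ : ℕ → ℕ, StrictMono φ ∧ CauchySeq fun n => J (x (φ n))

lemma CompactOn.mono {V V' : Submodule ℂ E} {J : E →L[ℂ] F} (h : CompactOn V J) (hV : V' ≤ V) :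
    CompactOn V' J := fun x hx hR => h x (fun n => hV (hx n)) hR

/-- The quadratic form of `A` controls the norm up to a multiple of the norm of the image
under `J`. -/
def CoerciveOn (V : Submodule ℂ E) (J : E →L[ℂ] F) (A : E →L[ℂ] E) : Prop :=
  ∃ C, ∀ ψ ∈ V, ‖ψ‖ ^ 2 ≤ quad A ψ + C * ‖J ψ‖ ^ 2

lemma CoerciveOn.mono {V V' : Submodule ℂ E} {J : E →L[ℂ] F} {A : E →L[ℂ] E}
    (h : CoerciveOn V J A) (hV : V' ≤ V) : CoerciveOn V' J A :=
  let ⟨C, hC⟩ := h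
  ⟨C, fun ψ hψ => hC ψ (hV hψ)⟩

/-- The direct method without weak limits. Along a minimising sequence with Cauchy $J$-images, the
parallelogram identity for `quad A`, with the lower bound $m\|J\cdot\|^2$ at the sum of two terms,
makes the form of their difference small. By coercivity the sequence is then Cauchy in `E` itself.
-/
theorem exists_quad_minimizer [CompleteSpace E] {V : Submodule ℂ E} {J : E →L[ℂ] F}
    {A : E →L[ℂ] E} (hV : IsClosed (V : Set E)) (hA : CoerciveOn V J A) (hJ : CompactOn V J)
    (hne : ∃ ψ ∈ V, J ψ ≠ 0) :
    ∃ ψ ∈ V, ‖J ψ‖ = 1 ∧ ∀ χ ∈ V, quad A ψ * ‖J χ‖ ^ 2 ≤ quad A χ := by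
  obtain ⟨C, hC⟩ := hA
  set S : Set ℝ := quad A '' {ψ | ψ ∈ V ∧ ‖J ψ‖ = 1} with hS
  have hscale : ∀ ψ ∈ V, J ψ ≠ 0 → ((‖J ψ‖⁻¹ : ℝ) : ℂ) • ψ ∈ {ψ | ψ ∈ V ∧ ‖J ψ‖ = 1} := by
    intro ψ hψ h
    refine ⟨V.smul_mem _ hψ, ?_⟩
    rw [map_smul, norm_smul]
    simp [norm_ne_zero_iff.2 h]
  have hSne : S.Nonempty := by
    obtain ⟨ψ, hψ, h⟩ := hne
    exact ⟨_, mem_image_of_mem _ (hscale ψ hψ h)⟩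
  have hSb : BddBelow S := by
    refine ⟨-C, ?_⟩
    rintro _ ⟨ψ, ⟨hψ, h1⟩, rfl⟩
    have := hC ψ hψ
    rw [h1] at this
    nlinarith [sq_nonneg ‖ψ‖]
  set m := sInf S with hm
  have hmin : ∀ χ ∈ V, m * ‖J χ‖ ^ 2 ≤ quad A χ := by
    intro χ hχ
    by_cases h : J χ = 0
    · have := hC χ hχ
      simp only [h, norm_zero] at this ⊢
      nlinarith [sq_nonneg ‖χ‖]
    · have h1 : m ≤ _ := csInf_le hSb (mem_image_of_mem (quad A) (hscale χ hχ h))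
      have h0 : 0 < ‖J χ‖ := norm_pos_iff.2 h
      rw [quad_smul] at h1
      simp only [Complex.norm_real, norm_inv, norm_norm, inv_pow] at h1
      rwa [inv_mul_eq_div, le_div_iff₀ (by positivity)] at h1
  obtain ⟨s, -, hslim, hsS⟩ := exists_seq_tendsto_sInf hSne hSb
  choose x hx hxs using hsS
  have hbdd : ∃ R, ∀ n, ‖x n‖ ≤ R := by
    obtain ⟨M, hM⟩ := hslim.bddAbove_range
    refine ⟨M + C + 1, fun n => ?_⟩
    have h1 := hC (x n) (hx n).1
    have h2 : s n ≤ M := hM ⟨n, rfl⟩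
    rw [(hx n).2, hxs] at h1
    nlinarith [sq_nonneg (‖x n‖ - 1)]
  obtain ⟨φ, hφ, hcau⟩ := hJ x (fun n => (hx n).1) hbdd
  have hslim' : Tendsto (fun n => quad A (x (φ n))) atTop (𝓝 m) := by
    simp only [hxs]
    exact hslim.comp hφ.tendsto_atTop
  have hkey : ∀ n k, ‖x (φ n) - x (φ k)‖ ^ 2 ≤ 2 * (quad A (x (φ n)) - m) +
      2 * (quad A (x (φ k)) - m) + (|m + C| + 1) * ‖J (x (φ n)) - J (x (φ k))‖ ^ 2 := by
    intro n k
    have h1 := hC _ (V.sub_mem (hx (φ n)).1 (hx (φ k)).1)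
    have h2 := hmin _ (V.add_mem (hx (φ n)).1 (hx (φ k)).1)
    have h3 := quad_sub_add_quad_add A (x (φ n)) (x (φ k))
    have h4 := parallelogram_law_with_norm ℂ (J (x (φ n))) (J (x (φ k)))
    rw [(hx (φ n)).2, (hx (φ k)).2] at h4
    rw [map_sub] at h1
    rw [map_add] at h2
    have h5 : ‖J (x (φ n)) + J (x (φ k))‖ ^ 2 = 4 - ‖J (x (φ n)) - J (x (φ k))‖ ^ 2 := by
      linarith
    rw [h5] at h2
    nlinarith [le_abs_self (m + C), sq_nonneg ‖J (x (φ n)) - J (x (φ k))‖]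
  have hcx : CauchySeq fun n => x (φ n) := by
    rw [Metric.cauchySeq_iff]
    intro ε hε
    set D := |m + C| + 1
    have hD : 0 < D := by positivity
    obtain ⟨N₁, hN₁⟩ := Metric.cauchySeq_iff.1 hcau (√(ε ^ 2 / (4 * D))) (by positivity)
    obtain ⟨N₂, hN₂⟩ := (hslim'.eventually_lt_const
      (show m < m + ε ^ 2 / 16 by nlinarith [sq_pos_of_pos hε])).exists_forall_of_atTop
    refine ⟨max N₁ N₂, fun n hn k hk => ?_⟩
    have h1 := hN₁ n (le_of_max_le_left hn) k (le_of_max_le_left hk)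
    have h2 := hN₂ n (le_of_max_le_right hn)
    have h3 := hN₂ k (le_of_max_le_right hk)
    rw [dist_eq_norm] at h1 ⊢
    have h4 : ‖J (x (φ n)) - J (x (φ k))‖ ^ 2 < ε ^ 2 / (4 * D) := by
      rwa [Real.lt_sqrt (norm_nonneg _)] at h1
    have h5 : D * ‖J (x (φ n)) - J (x (φ k))‖ ^ 2 < ε ^ 2 / 4 := by
      rw [lt_div_iff₀ (by positivity)] at h4
      linarith
    have h6 := hkey n k
    exact lt_of_pow_lt_pow_left₀ 2 hε.le (by linarith [pow_pos hε 2])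
  obtain ⟨ψ, hψ⟩ := cauchySeq_tendsto_of_complete hcx
  have hq : quad A ψ = m :=
    tendsto_nhds_unique (((continuous_quad A).tendsto ψ).comp hψ) hslim'
  refine ⟨ψ, hV.mem_of_tendsto hψ (.of_forall fun n => (hx (φ n)).1), ?_, ?_⟩
  · have h1 : Tendsto (fun n => ‖J (x (φ n))‖) atTop (𝓝 ‖J ψ‖) :=
      ((J.continuous.norm).tendsto ψ).comp hψ
    simp only [(hx _).2] at h1
    exact tendsto_nhds_unique h1 tendsto_const_nhds
  · rw [hq]
    exact hmin

/-- `ψ` is an eigenvector of the form `⟨χ, A ψ⟩` on `V`, relative to `⟨J χ, J ψ⟩`. -/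
def IsFormEigenvector (V : Submodule ℂ E) (J : E →L[ℂ] F) (A : E →L[ℂ] E) (μ : ℝ) (ψ : E) : Prop :=
  ψ ∈ V ∧ ψ ≠ 0 ∧ ∀ χ ∈ V, inner ℂ χ (A ψ) = (μ : ℂ) * inner ℂ (J χ) (J ψ)

lemma IsFormEigenvector.quad_eq {V : Submodule ℂ E} {J : E →L[ℂ] F} {A : E →L[ℂ] E} {μ : ℝ} {ψ : E}
    (h : IsFormEigenvector V J A μ ψ) : quad A ψ = μ * ‖J ψ‖ ^ 2 := by
  rw [quad, h.2.2 ψ h.1, inner_self_eq_norm_sq_to_K, Complex.re_ofReal_mul]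
  norm_cast

/-- First variation: along `ψ + t χ` the defect `quad A - μ ‖J ·‖ ^ 2` is a nonnegative real
quadratic in `t` without constant term. Its discriminant is the square of the linear coefficient,
which must therefore vanish. -/
lemma re_inner_eq_of_quad_minimizer {V : Submodule ℂ E} {J : E →L[ℂ] F}
    {A : E →L[ℂ] E} (hA : A.IsSymmetric) {μ : ℝ} {ψ : E} (hψ : ψ ∈ V)
    (hq : quad A ψ = μ * ‖J ψ‖ ^ 2) (hmin : ∀ χ ∈ V, μ * ‖J χ‖ ^ 2 ≤ quad A χ)
    {χ : E} (hχ : χ ∈ V) :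
    (inner ℂ χ (A ψ)).re = μ * (inner ℂ (J χ) (J ψ)).re := by
  have h : ∀ t : ℝ, 0 ≤ (quad A χ - μ * ‖J χ‖ ^ 2) * (t * t) +
      (2 * ((inner ℂ χ (A ψ)).re - μ * (inner ℂ (J χ) (J ψ)).re)) * t + 0 := by
    intro t
    have h1 := hmin (ψ + (t : ℂ) • χ) (V.add_mem hψ (V.smul_mem _ hχ))
    have h2 : (inner ℂ ψ (A χ)).re = (inner ℂ χ (A ψ)).re := by
      have := hA ψ χ
      simp only [ContinuousLinearMap.coe_coe] at this
      rw [← this, ← inner_conj_symm, Complex.conj_re]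
    have h3 : quad A (ψ + (t : ℂ) • χ) =
        quad A ψ + 2 * t * (inner ℂ χ (A ψ)).re + t ^ 2 * quad A χ := by
      simp only [quad, map_add, map_smul, inner_add_left, inner_add_right, inner_smul_left,
        inner_smul_right, Complex.add_re, Complex.conj_ofReal, Complex.re_ofReal_mul, h2]
      ring
    have h4 : ‖J (ψ + (t : ℂ) • χ)‖ ^ 2 =
        ‖J ψ‖ ^ 2 + 2 * t * (inner ℂ (J χ) (J ψ)).re + t ^ 2 * ‖J χ‖ ^ 2 := by
      rw [map_add, map_smul, @norm_add_sq ℂ, inner_smul_right, norm_smul, mul_pow]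
      have : (inner ℂ (J ψ) (J χ)).re = (inner ℂ (J χ) (J ψ)).re := by
        rw [← inner_conj_symm, Complex.conj_re]
      simp only [RCLike.re_to_complex, Complex.re_ofReal_mul, this, Complex.norm_real,
        Real.norm_eq_abs, sq_abs]
      ring
    rw [h3, h4] at h1
    nlinarith
  have h5 := discrim_le_zero h
  rw [discrim] at h5
  nlinarith [sq_nonneg (2 * ((inner ℂ χ (A ψ)).re - μ * (inner ℂ (J χ) (J ψ)).re))]

lemma inner_eq_of_quad_minimizer {V : Submodule ℂ E} {J : E →L[ℂ] F}
    {A : E →L[ℂ] E} (hA : A.IsSymmetric) {μ : ℝ} {ψ : E} (hψ : ψ ∈ V)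
    (hq : quad A ψ = μ * ‖J ψ‖ ^ 2) (hmin : ∀ χ ∈ V, μ * ‖J χ‖ ^ 2 ≤ quad A χ)
    {χ : E} (hχ : χ ∈ V) :
    inner ℂ χ (A ψ) = (μ : ℂ) * inner ℂ (J χ) (J ψ) := by
  apply Complex.ext
  · rw [Complex.re_ofReal_mul]
    exact re_inner_eq_of_quad_minimizer hA hψ hq hmin hχ
  -- Antilinearity in the first slot turns the real part for `Complex.I • χ` into the imaginary part
  -- for `χ`.
  · have := re_inner_eq_of_quad_minimizer hA hψ hq hmin (V.smul_mem Complex.I hχ)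
    simp only [map_smul, inner_smul_left, Complex.conj_I] at this
    simpa using this

/-- All real `t` such that at least `k` eigenvalues are at most `t`, with multiplicity. -/
def formEigenvalueBounds (V : Submodule ℂ E) (J : E →L[ℂ] F) (A : E →L[ℂ] E) (k : ℕ) : Set ℝ :=
  {t | ∃ ψ : Fin k → E, LinearIndependent ℂ ψ ∧
    ∀ j, ∃ μ ≤ t, IsFormEigenvector V J A μ (ψ j)}

lemma IsFormEigenvector.inner_eq_zero {V : Submodule ℂ E} {J : E →L[ℂ] F} {A : E →L[ℂ] E}
    (hA : A.IsSymmetric) {μ₁ μ₂ : ℝ} {ψ₁ ψ₂ : E} (h₁ : IsFormEigenvector V J A μ₁ ψ₁)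
    (h₂ : IsFormEigenvector V J A μ₂ ψ₂) (hne : μ₁ ≠ μ₂) : inner ℂ (J ψ₁) (J ψ₂) = 0 := by
  have e₁ := h₁.2.2 ψ₂ h₂.1
  have e₂ := h₂.2.2 ψ₁ h₁.1
  have e₃ := hA ψ₁ ψ₂
  simp only [ContinuousLinearMap.coe_coe] at e₃
  rw [← e₃, ← inner_conj_symm, e₁, map_mul, Complex.conj_ofReal, inner_conj_symm] at e₂
  have : ((μ₁ : ℂ) - μ₂) * inner ℂ (J ψ₁) (J ψ₂) = 0 := by rw [sub_mul, e₂, sub_self]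
  refine (mul_eq_zero.1 this).resolve_left ?_
  rw [sub_eq_zero]
  exact_mod_cast hne

/-- The span of two eigenvectors contains a vector that is orthogonal to a given one. -/
theorem exists_orthogonal_of_mem_formEigenvalueBounds {V : Submodule ℂ E} {J : E →L[ℂ] F}
    {A : E →L[ℂ] E} (hA : A.IsSymmetric) (hco : CoerciveOn V J A) {t : ℝ}
    (ht : t ∈ formEigenvalueBounds V J A 2) (η : F) :
    ∃ ψ ∈ V, J ψ ≠ 0 ∧ inner ℂ η (J ψ) = 0 ∧ quad A ψ ≤ t * ‖J ψ‖ ^ 2 := by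
  obtain ⟨ψ, hli, hψ⟩ := ht
  obtain ⟨μ₀, hμ₀, h₀⟩ := hψ 0
  obtain ⟨μ₁, hμ₁, h₁⟩ := hψ 1
  -- One linear equation in two unknowns has a nontrivial solution.
  obtain ⟨a, b, hab, horth⟩ : ∃ a b : ℂ, (a ≠ 0 ∨ b ≠ 0) ∧
      inner ℂ η (J (a • ψ 0 + b • ψ 1)) = 0 := by
    by_cases hz : inner ℂ η (J (ψ 0)) = 0
    · exact ⟨1, 0, by simp, by simp [hz]⟩
    · refine ⟨inner ℂ η (J (ψ 1)), -inner ℂ η (J (ψ 0)), Or.inr (neg_ne_zero.2 hz), ?_⟩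
      simp only [map_add, map_smul, inner_add_right, inner_smul_right]
      ring
  set ξ := a • ψ 0 + b • ψ 1 with hξ
  have hξV : ξ ∈ V := V.add_mem (V.smul_mem _ h₀.1) (V.smul_mem _ h₁.1)
  have hform : ∀ χ ∈ V, inner ℂ χ (A ξ) =
      a * (μ₀ * inner ℂ (J χ) (J (ψ 0))) + b * (μ₁ * inner ℂ (J χ) (J (ψ 1))) := by
    intro χ hχ
    simp only [hξ, map_add, map_smul, inner_add_right, inner_smul_right, h₀.2.2 χ hχ,
      h₁.2.2 χ hχ]
  have hquad : quad A ξ ≤ t * ‖J ξ‖ ^ 2 := by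
    -- The two eigenvectors need not be orthogonal. If the eigenvalues agree, `ξ` satisfies the same
    -- eigenvalue equation; if not, the $J$-images are orthogonal by symmetry and the cross terms
    -- vanish.
    by_cases hμ : μ₀ = μ₁
    · subst hμ
      have : quad A ξ = μ₀ * ‖J ξ‖ ^ 2 := by
        have h2 : inner ℂ ξ (A ξ) = μ₀ * inner ℂ (J ξ) (J ξ) := by
          rw [hform ξ hξV]
          nth_rewrite 4 [hξ]
          simp only [map_add, map_smul, inner_add_right, inner_smul_right]
          ring
        rw [quad, h2, inner_self_eq_norm_sq_to_K, Complex.re_ofReal_mul]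
        norm_cast
      rw [this]
      gcongr
    · have ho := h₀.inner_eq_zero hA h₁ hμ
      have ho' : inner ℂ (J (ψ 1)) (J (ψ 0)) = 0 := inner_eq_zero_symm.1 ho
      have e1 : quad A ξ = μ₀ * (‖a‖ ^ 2 * ‖J (ψ 0)‖ ^ 2) + μ₁ * (‖b‖ ^ 2 * ‖J (ψ 1)‖ ^ 2) := by
        have h2 : inner ℂ ξ (A ξ) = ((μ₀ * (‖a‖ ^ 2 * ‖J (ψ 0)‖ ^ 2) +
            μ₁ * (‖b‖ ^ 2 * ‖J (ψ 1)‖ ^ 2) : ℝ) : ℂ) := by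
          rw [hform ξ hξV]
          simp only [hξ, map_add, map_smul, inner_add_left, inner_smul_left, ho, ho',
            inner_self_eq_norm_sq_to_K]
          push_cast
          rw [← Complex.mul_conj' a, ← Complex.mul_conj' b]
          simp only [Complex.coe_algebraMap]
          ring
        rw [quad, h2, Complex.ofReal_re]
      have e2 : ‖J ξ‖ ^ 2 = ‖a‖ ^ 2 * ‖J (ψ 0)‖ ^ 2 + ‖b‖ ^ 2 * ‖J (ψ 1)‖ ^ 2 := by
        rw [hξ, map_add, map_smul, map_smul, @norm_add_sq ℂ, inner_smul_left, inner_smul_right, ho,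
          norm_smul, norm_smul]
        simp only [mul_zero, map_zero]
        ring
      rw [e1, e2, mul_add]
      gcongr
  refine ⟨ξ, hξV, fun h => ?_, horth, hquad⟩
  -- If `J ξ = 0`, the form is nonpositive at `ξ`; coercivity then forces `ξ = 0`, against linear
  -- independence.
  obtain ⟨C, hC⟩ := hco
  have h0 : ξ = 0 := by
    have := hC ξ hξV
    rw [h] at this hquad
    simp only [norm_zero] at this hquad
    have h2 : ‖ξ‖ ^ 2 ≤ 0 := by linarith
    exact norm_eq_zero.1 (pow_eq_zero_iff two_ne_zero |>.1 (le_antisymm h2 (sq_nonneg _)))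
  have := LinearIndependent.pair_iff.1 (show LinearIndependent ℂ ![ψ 0, ψ 1] by
    convert hli using 1
    ext i
    fin_cases i <;> rfl) a b h0
  tauto

/-- The data of the first two eigenvalues of a form. -/
structure IsLowestPair (V : Submodule ℂ E) (J : E →L[ℂ] F) (A : E →L[ℂ] E)
    (μ₁ μ₂ : ℝ) (ψ₁ : E) : Prop where
  isLeast_one : IsLeast (formEigenvalueBounds V J A 1) μ₁
  isLeast_two : IsLeast (formEigenvalueBounds V J A 2) μ₂
  le_quad : ∀ χ ∈ V, μ₁ * ‖J χ‖ ^ 2 ≤ quad A χ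
  le_quad_of_orthogonal : ∀ χ ∈ V, inner ℂ (J ψ₁) (J χ) = 0 → μ₂ * ‖J χ‖ ^ 2 ≤ quad A χ

/-- Minimise over `V`, then over the part of `V` whose $J$-image is orthogonal to that of the first
minimiser. That no smaller bound for two eigenvalues exists follows by testing the second minimum on
the orthogonal vector that any two eigenvectors provide. -/
theorem exists_isLowestPair [CompleteSpace E] {V : Submodule ℂ E} {J : E →L[ℂ] F}
    {A : E →L[ℂ] E} (hV : IsClosed (V : Set E)) (hA : A.IsSymmetric) (hco : CoerciveOn V J A)
    (hJ : CompactOn V J) (hne : ∃ f ∈ V, ∃ g ∈ V, LinearIndependent ℂ ![J f, J g]) :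
    ∃ μ₁ μ₂ ψ₁, IsLowestPair V J A μ₁ μ₂ ψ₁ := by
  obtain ⟨f, hf, g, hg, hfg⟩ := hne
  rw [LinearIndependent.pair_iff] at hfg
  obtain ⟨ψ₁, hψ₁, hn₁, hm₁⟩ := exists_quad_minimizer hV hco hJ ⟨f, hf, fun h => by
    have := hfg 1 0 (by simp [h]); simp at this⟩
  set μ₁ := quad A ψ₁ with hμ₁
  have hJψ₁ : J ψ₁ ≠ 0 := by rw [← norm_ne_zero_iff, hn₁]; exact one_ne_zero
  have hE₁ : ∀ χ ∈ V, inner ℂ χ (A ψ₁) = (μ₁ : ℂ) * inner ℂ (J χ) (J ψ₁) := fun χ hχ =>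
    inner_eq_of_quad_minimizer hA hψ₁ (by rw [hn₁]; simp [hμ₁]) hm₁ hχ
  have hI₁ : IsFormEigenvector V J A μ₁ ψ₁ := ⟨hψ₁, fun h => hJψ₁ (by simp [h]), hE₁⟩
  set L : E →L[ℂ] ℂ := (innerSL ℂ (J ψ₁)).comp J with hL
  have hLapp : ∀ χ, L χ = inner ℂ (J ψ₁) (J χ) := fun χ => rfl
  set V' : Submodule ℂ E := V ⊓ (L : E →ₗ[ℂ] ℂ).ker with hV'
  have hmemV' : ∀ χ, χ ∈ V' ↔ χ ∈ V ∧ inner ℂ (J ψ₁) (J χ) = 0 := fun χ => Iff.rfl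
  have hV'c : IsClosed (V' : Set E) := hV.inter L.isClosed_ker
  have hle : V' ≤ V := inf_le_left
  obtain ⟨ψ₂, hψ₂, hn₂, hm₂⟩ := exists_quad_minimizer hV'c (hco.mono hle) (hJ.mono hle) (by
    by_cases hz : inner ℂ (J ψ₁) (J f) = 0
    · exact ⟨f, (hmemV' f).2 ⟨hf, hz⟩, fun h => by have := hfg 1 0 (by simp [h]); simp at this⟩
    -- This combination lies in the kernel of `L`. A vanishing $J$-image would give `L f = 0` by
    -- independence of `J f` and `J g`.
    · refine ⟨L g • f - L f • g, (hmemV' _).2 ⟨?_, ?_⟩, fun h => hz ?_⟩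
      · exact V.sub_mem (V.smul_mem _ hf) (V.smul_mem _ hg)
      · simp only [map_sub, map_smul, inner_sub_right, inner_smul_right, hLapp]
        ring
      · have := hfg (L g) (-L f) (by rw [neg_smul, ← sub_eq_add_neg, ← h]; simp)
        exact neg_eq_zero.1 this.2)
  set μ₂ := quad A ψ₂ with hμ₂
  have hJψ₂ : J ψ₂ ≠ 0 := by rw [← norm_ne_zero_iff, hn₂]; exact one_ne_zero
  have ho : inner ℂ (J ψ₁) (J ψ₂) = 0 := ((hmemV' _).1 hψ₂).2
  have hE₂ : ∀ χ ∈ V, inner ℂ χ (A ψ₂) = (μ₂ : ℂ) * inner ℂ (J χ) (J ψ₂) := by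
    intro χ hχ
    -- The minimum over `V'` gives the eigenvalue equation only against `V'`. Every `χ` differs from
    -- an element of `V'` by a multiple of `ψ₁`, on which both sides vanish by symmetry and
    -- orthogonality.
    have h1 : χ - L χ • ψ₁ ∈ V' := by
      refine (hmemV' _).2 ⟨V.sub_mem hχ (V.smul_mem _ hψ₁), ?_⟩
      simp only [map_sub, map_smul, inner_sub_right, inner_smul_right,
        inner_self_eq_norm_sq_to_K, hn₁, hLapp]
      simp
    have h2 := inner_eq_of_quad_minimizer hA hψ₂ (by rw [hn₂]; simp [hμ₂]) hm₂ h1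
    have h3 : inner ℂ ψ₁ (A ψ₂) = 0 := by
      have := hA ψ₁ ψ₂
      simp only [ContinuousLinearMap.coe_coe] at this
      rw [← this, ← inner_conj_symm, hE₁ ψ₂ (hle hψ₂), map_mul, inner_conj_symm, ho, mul_zero]
    simpa only [map_sub, map_smul, inner_sub_left, inner_smul_left, ho, h3, mul_zero,
      sub_zero] using h2
  have hI₂ : IsFormEigenvector V J A μ₂ ψ₂ := ⟨hle hψ₂, fun h => hJψ₂ (by simp [h]), hE₂⟩
  have hm₂' : ∀ χ ∈ V, inner ℂ (J ψ₁) (J χ) = 0 → μ₂ * ‖J χ‖ ^ 2 ≤ quad A χ :=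
    fun χ h1 h2 => hm₂ χ ((hmemV' χ).2 ⟨h1, h2⟩)
  have h12 : μ₁ ≤ μ₂ := by simpa [hn₂] using hm₁ ψ₂ (hle hψ₂)
  refine ⟨μ₁, μ₂, ψ₁, ⟨?_, ?_⟩, ⟨?_, ?_⟩, hm₁, hm₂'⟩
  · refine ⟨fun _ => ψ₁, ?_, fun _ => ⟨μ₁, le_rfl, hI₁⟩⟩
    exact LinearIndependent.of_subsingleton 0 hI₁.2.1
  · rintro t ⟨ψ, -, hψ⟩
    obtain ⟨μ, hμ, h⟩ := hψ 0
    refine le_trans ?_ hμ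
    have h1 := hm₁ _ h.1
    rw [h.quad_eq] at h1
    by_cases hz : J (ψ 0) = 0
    · obtain ⟨C, hC⟩ := hco
      have h2 := hC _ h.1
      rw [h.quad_eq, hz] at h2
      simp only [norm_zero] at h2
      exact absurd (norm_eq_zero.1 (pow_eq_zero_iff two_ne_zero |>.1
        (le_antisymm (by linarith) (sq_nonneg _)))) h.2.1
    · exact le_of_mul_le_mul_right h1 (by have := norm_pos_iff.2 hz; positivity)
  · refine ⟨![ψ₁, ψ₂], ?_, fun j => ?_⟩
    · rw [LinearIndependent.pair_iff]
      intro a b hab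
      have h1 : J (a • ψ₁ + b • ψ₂) = 0 := by rw [hab, map_zero]
      have h2 : inner ℂ (J ψ₁) (J (a • ψ₁ + b • ψ₂)) = a := by
        simp only [map_add, map_smul, inner_add_right, inner_smul_right, ho,
          inner_self_eq_norm_sq_to_K, hn₁]
        simp
      have ha : a = 0 := by rw [← h2, h1, inner_zero_right]
      subst ha
      simp only [zero_smul, zero_add, map_smul] at h1
      exact ⟨rfl, (smul_eq_zero.1 h1).resolve_right hJψ₂⟩
    · fin_cases j
      · exact ⟨μ₁, h12, hI₁⟩
      · exact ⟨μ₂, le_rfl, hI₂⟩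
  · intro t ht
    obtain ⟨χ, hχ, hz, horth, hq⟩ := exists_orthogonal_of_mem_formEigenvalueBounds hA hco ht (J ψ₁)
    exact le_of_mul_le_mul_right ((hm₂' χ hχ horth).trans hq)
      (by have := norm_pos_iff.2 hz; positivity)

end Abstract

/-! ### Rellich compactness of `H^1_0` of a bounded set -/

section Rellich

open Filter Topology

variable {d : ℕ}

lemma L2_inner (f g : L2 d) : inner ℂ f g = ∫ x, conj (f x) * g x := by
  rw [L2.inner_def]
  simp only [RCLike.inner_apply']

lemma L2_norm_sq (f : L2 d) : ‖f‖ ^ 2 = ∫ x, ‖f x‖ ^ 2 := by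
  have h : inner ℂ f f = ((∫ x, ‖f x‖ ^ 2 : ℝ) : ℂ) := by
    rw [L2_inner, ← integral_complex_ofReal]
    congr 1 with x
    rw [Complex.conj_mul', Complex.ofReal_pow]
  apply Complex.ofReal_injective
  rw [← h, inner_self_eq_norm_sq_to_K]
  norm_cast

lemma Jet_norm_sq (w : Jet d) : ‖w‖ ^ 2 = ‖w.fst‖ ^ 2 + ∑ i, ‖w.snd i‖ ^ 2 := by
  rw [WithLp.prod_norm_sq_eq_of_L2, PiLp.norm_sq_eq_of_L2]

/-- The map `(ψ, ∇ψ) ↦ ψ`. -/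
def fstCLM (d : ℕ) : Jet d →L[ℂ] L2 d := WithLp.fstL 2 ℂ (L2 d) (PiLp 2 fun _ : Fin d => L2 d)

@[simp] lemma fstCLM_apply (w : Jet d) : fstCLM d w = w.fst := rfl

/-- A test function as a Schwartz function. -/
def IsTest.toSchwartz {U : Set (Space d)} {f : Space d → ℂ} (hf : IsTest U f) :
    SchwartzMap (Space d) ℂ := hf.2.1.toSchwartzMap hf.1

@[simp] lemma IsTest.toSchwartz_apply {U : Set (Space d)} {f : Space d → ℂ} (hf : IsTest U f)
    (x : Space d) : hf.toSchwartz x = f x := rfl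

lemma SchwartzMap_integrable_norm_sq (f : SchwartzMap (Space d) ℂ) :
    Integrable fun x => ‖f x‖ ^ 2 :=
  (f.memLp 2 volume).integrable_norm_pow (by norm_num)

/-- The transform turns $\partial_i$ into multiplication by $2\pi\mathrm i\,\xi_i$; sum the squares
over $i$. -/
lemma norm_sq_mul_fourier_eq (f : SchwartzMap (Space d) ℂ) (ξ : Space d) :
    (2 * Real.pi) ^ 2 * (‖ξ‖ ^ 2 * ‖𝓕 f ξ‖ ^ 2) = ∑ i : Fin d,
      ‖𝓕 (LineDeriv.lineDerivOp (EuclideanSpace.single i (1 : ℝ) : Space d) f) ξ‖ ^ 2 := by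
  rw [EuclideanSpace.norm_sq_eq, Finset.sum_mul, Finset.mul_sum]
  refine Finset.sum_congr rfl fun i _ => ?_
  have : (fun x : Space d => inner ℝ x (EuclideanSpace.single i (1 : ℝ))).HasTemperateGrowth :=
    ((innerSL ℝ).flip (EuclideanSpace.single i (1 : ℝ) : Space d)).hasTemperateGrowth
  rw [SchwartzMap.fourier_lineDerivOp_eq, _root_.smul_apply,
    SchwartzMap.smulLeftCLM_apply_apply this]
  simp [EuclideanSpace.inner_single_right, mul_pow]

lemma integral_norm_sq_mul_fourier_le (f : SchwartzMap (Space d) ℂ) :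
    Integrable (fun ξ => ‖ξ‖ ^ 2 * ‖𝓕 f ξ‖ ^ 2) ∧ ∫ ξ, ‖ξ‖ ^ 2 * ‖𝓕 f ξ‖ ^ 2 ≤
      ∑ i : Fin d, ∫ x, ‖fderiv ℝ f x (EuclideanSpace.single i 1)‖ ^ 2 := by
  have h1 : Integrable (fun ξ => (2 * Real.pi) ^ 2 * (‖ξ‖ ^ 2 * ‖𝓕 f ξ‖ ^ 2)) := by
    simp only [norm_sq_mul_fourier_eq]
    exact integrable_finsetSum _ fun i _ => SchwartzMap_integrable_norm_sq _
  have h2 : (2 * Real.pi) ^ 2 * ∫ ξ, ‖ξ‖ ^ 2 * ‖𝓕 f ξ‖ ^ 2 =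
      ∑ i : Fin d, ∫ x, ‖fderiv ℝ f x (EuclideanSpace.single i 1)‖ ^ 2 := by
    rw [← integral_const_mul]
    simp only [norm_sq_mul_fourier_eq]
    rw [integral_finsetSum _ fun i _ => SchwartzMap_integrable_norm_sq _]
    refine Finset.sum_congr rfl fun i _ => ?_
    rw [SchwartzMap.integral_norm_sq_fourier]
    rfl
  refine ⟨?_, ?_⟩
  · have h3 := h1.const_mul (((2 * Real.pi) ^ 2)⁻¹)
    refine h3.congr (.of_forall fun ξ => ?_)
    have := Real.pi_pos
    simp only
    field_simp
  · rw [← h2]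
    have h4 : 0 ≤ ∫ ξ, ‖ξ‖ ^ 2 * ‖𝓕 f ξ‖ ^ 2 := integral_nonneg fun ξ => by positivity
    have h5 : 1 ≤ (2 * Real.pi) ^ 2 := by nlinarith [Real.pi_gt_three]
    exact le_mul_of_one_le_left h4 h5

/-- Plancherel, split at $|\xi|=R$: outside the ball $1\le|\xi|^2/R^2$, so the gradient controls the
high frequencies. -/
lemma integral_norm_sq_le_of_fourier (f : SchwartzMap (Space d) ℂ) {R : ℝ} (hR : 0 < R) :
    ∫ x, ‖f x‖ ^ 2 ≤ (∫ ξ in Metric.ball 0 R, ‖𝓕 f ξ‖ ^ 2) +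
      (R ^ 2)⁻¹ * ∑ i : Fin d, ∫ x, ‖fderiv ℝ f x (EuclideanSpace.single i 1)‖ ^ 2 := by
  obtain ⟨h1, h2⟩ := integral_norm_sq_mul_fourier_le f
  rw [← SchwartzMap.integral_norm_sq_fourier,
    ← integral_add_compl (s := Metric.ball 0 R) Metric.isOpen_ball.measurableSet
      (SchwartzMap_integrable_norm_sq (𝓕 f))]
  gcongr
  refine le_trans ?_ (mul_le_mul_of_nonneg_left h2 (by positivity))
  rw [← integral_const_mul]
  refine le_trans (b := ∫ ξ in (Metric.ball 0 R)ᶜ, (R ^ 2)⁻¹ * (‖ξ‖ ^ 2 * ‖𝓕 f ξ‖ ^ 2)) ?_ ?_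
  · refine setIntegral_mono_on (SchwartzMap_integrable_norm_sq (𝓕 f)).integrableOn
      (h1.const_mul _).integrableOn Metric.isOpen_ball.measurableSet.compl fun ξ hξ => ?_
    have : R ≤ ‖ξ‖ := by simpa using hξ
    rw [inv_mul_eq_div, le_div_iff₀ (by positivity), mul_comm]
    gcongr
  · exact setIntegral_le_integral (h1.const_mul _) (.of_forall fun ξ => by positivity)

/-- The exponential `exp(2πi⟨x,ξ⟩)`, cut off to a ball. -/
def cutExp (R : ℝ) (ξ : Space d) : Space d → ℂ :=
  (Metric.closedBall 0 R).indicator fun x => ((𝐞 (inner ℝ x ξ) : Circle) : ℂ)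

lemma norm_cutExp_le (R : ℝ) (ξ x : Space d) :
    ‖cutExp R ξ x‖ ≤ (Metric.closedBall (0 : Space d) R).indicator (fun _ => (1 : ℝ)) x := by
  by_cases hx : x ∈ Metric.closedBall (0 : Space d) R <;> simp [cutExp, hx, Circle.norm_coe]

lemma memLp_cutExp (R : ℝ) (ξ : Space d) : MemLp (cutExp R ξ) 2 volume := by
  have h1 : MemLp ((Metric.closedBall (0 : Space d) R).indicator fun _ => (1 : ℝ)) 2 volume :=
    memLp_indicator_const 2 Metric.isClosed_closedBall.measurableSet 1
      (Or.inr (isCompact_closedBall 0 R).measure_lt_top.ne)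
  refine h1.mono ?_ (.of_forall fun x => (norm_cutExp_le R ξ x).trans (le_abs_self _))
  refine AEStronglyMeasurable.indicator ?_ Metric.isClosed_closedBall.measurableSet
  refine Continuous.aestronglyMeasurable ?_
  exact continuous_subtype_val.comp (Real.continuous_fourierChar.comp (by fun_prop))

/-- The cut-off exponential as an element of `L²`. -/
def cutExpL2 (R : ℝ) (ξ : Space d) : L2 d := (memLp_cutExp R ξ).toLp

lemma norm_cutExpL2_le (R : ℝ) (ξ : Space d) :
    ‖cutExpL2 R ξ‖ ^ 2 ≤ (volume (Metric.closedBall (0 : Space d) R)).toReal := by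
  rw [L2_norm_sq]
  have h1 : Integrable ((Metric.closedBall (0 : Space d) R).indicator fun _ => (1 : ℝ)) :=
    (integrable_indicator_iff Metric.isClosed_closedBall.measurableSet).2
      (integrableOn_const (isCompact_closedBall 0 R).measure_lt_top.ne)
  have h2 : ∫ x, (Metric.closedBall (0 : Space d) R).indicator (fun _ => (1 : ℝ)) x =
      (volume (Metric.closedBall (0 : Space d) R)).toReal := by
    rw [integral_indicator_const _ Metric.isClosed_closedBall.measurableSet]
    simp [Measure.real]
  rw [← h2]
  refine integral_mono_ae ?_ h1 ?_
  · exact (Lp.memLp (cutExpL2 R ξ)).integrable_norm_pow (by norm_num)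
  · filter_upwards [(memLp_cutExp R ξ).coeFn_toLp] with x hx
    rw [cutExpL2, hx]
    have := norm_cutExp_le R ξ x
    by_cases hx : x ∈ Metric.closedBall (0 : Space d) R
    · simp only [hx, indicator_of_mem] at this ⊢
      exact pow_le_one₀ (norm_nonneg _) this
    · simp only [hx, not_false_eq_true, indicator_of_notMem] at this ⊢
      rw [le_antisymm this (norm_nonneg _)]
      norm_num

/-- On functions supported in a fixed ball, evaluating the transform at a point is pairing with a
fixed `L²` vector. Weak convergence thus gives pointwise convergence of the transforms. -/
lemma fourier_eq_inner_cutExp {U : Set (Space d)} {f : Space d → ℂ} (hf : IsTest U f) {R : ℝ}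
    (hU : U ⊆ Metric.closedBall 0 R) {F : L2 d} (hF : F =ᵐ[volume] f) (ξ : Space d) :
    𝓕 hf.toSchwartz ξ = inner ℂ (cutExpL2 R ξ) F := by
  rw [SchwartzMap.fourier_coe, Real.fourier_eq, L2_inner]
  refine integral_congr_ae ?_
  filter_upwards [hF, (memLp_cutExp R ξ).coeFn_toLp] with x hx h2
  rw [hx, cutExpL2, h2, cutExp]
  by_cases hxR : x ∈ Metric.closedBall (0 : Space d) R
  · rw [indicator_of_mem hxR, IsTest.toSchwartz_apply, ← Circle.coe_inv_eq_conj,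
      AddChar.map_neg_eq_inv]
    rfl
  · have : f x = 0 := image_eq_zero_of_notMem_tsupport fun h => hxR (hU (hf.2.2 h))
    simp [this]

/-- A bounded sequence in `L²` has a weakly convergent subsequence. -/
lemma exists_subseq_inner_cauchy (F : ℕ → L2 d) {C : ℝ} (hC : ∀ n, ‖F n‖ ≤ C) :
    ∃ φ : ℕ → ℕ, StrictMono φ ∧ ∀ g : L2 d, CauchySeq fun n => inner ℂ g (F (φ n)) := by
  -- A finite exponent makes `L2 d` separable, so that balls of its dual are weak-* sequentially
  -- compact.
  have : Fact ((2 : ℝ≥0∞) ≠ ∞) := ⟨by norm_num⟩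
  have hc := WeakDual.isSeqCompact_closedBall ℂ (L2 d) 0 C
  obtain ⟨a, -, φ, hφ, hlim⟩ := hc
    (x := fun n => StrongDual.toWeakDual (innerSL ℂ (F n))) fun n => by
      simp only [mem_preimage, Metric.mem_closedBall, dist_zero_right]
      exact (innerSL_apply_norm ℂ (F n)).trans_le (hC n)
  refine ⟨φ, hφ, fun g => ?_⟩
  have h1 := ((WeakDual.eval_continuous g).tendsto a).comp hlim
  have h2 : Tendsto (fun n => inner ℂ g (F (φ n))) atTop (𝓝 (conj (a g))) := by
    refine ((Complex.continuous_conj.tendsto _).comp h1).congr fun n => ?_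
    simp only [Function.comp_apply]
    exact inner_conj_symm g (F (φ n))
  exact h2.cauchySeq

lemma IsTest.sub {U : Set (Space d)} {f g : Space d → ℂ} (hf : IsTest U f) (hg : IsTest U g) :
    IsTest U (f - g) :=
  ⟨hf.1.sub hg.1, hf.2.1.sub hg.2.1, (tsupport_sub f g).trans (union_subset hf.2.2 hg.2.2)⟩

lemma norm_fst_sq_le_of_fourier {U : Set (Space d)} {f : Space d → ℂ} (hf : IsTest U f)
    {w : Jet d} (hwf : w.fst =ᵐ[volume] f) (hwd : ∀ i, w.snd i =ᵐ[volume] partialDeriv i f)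
    {R : ℝ} (hR : 0 < R) :
    ‖w.fst‖ ^ 2 ≤ (∫ ξ in Metric.ball 0 R, ‖𝓕 hf.toSchwartz ξ‖ ^ 2) + (R ^ 2)⁻¹ * ‖w‖ ^ 2 := by
  have h := integral_norm_sq_le_of_fourier hf.toSchwartz hR
  have h1 : ‖w.fst‖ ^ 2 = ∫ x, ‖hf.toSchwartz x‖ ^ 2 := by
    rw [L2_norm_sq]
    exact integral_congr_ae (hwf.mono fun x hx => by simp only [hx, IsTest.toSchwartz_apply])
  have h2 : ∑ i : Fin d, ∫ x, ‖fderiv ℝ hf.toSchwartz x (EuclideanSpace.single i 1)‖ ^ 2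
      = ∑ i, ‖w.snd i‖ ^ 2 := by
    refine Finset.sum_congr rfl fun i _ => ?_
    rw [L2_norm_sq]
    exact integral_congr_ae ((hwd i).mono fun x hx => by simp only [hx]; rfl)
  rw [h1]
  refine h.trans ?_
  rw [h2, Jet_norm_sq]
  gcongr
  linarith [sq_nonneg ‖w.fst‖]

/-- Take a weakly convergent subsequence. The transforms of differences tend to zero pointwise under
a uniform bound, so dominated convergence handles each frequency ball. The rest is at most $r^{-2}$
times the squared `H¹` norm, uniformly small for large $r$. -/
theorem exists_subseq_cauchy_of_testJets {U : Set (Space d)} (hU : Bornology.IsBounded U)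
    (w : ℕ → Jet d) (hw : ∀ n, w n ∈ testJets U) {C : ℝ} (hC : ∀ n, ‖w n‖ ≤ C) :
    ∃ φ : ℕ → ℕ, StrictMono φ ∧ CauchySeq fun n => (w (φ n)).fst := by
  obtain ⟨R, hR⟩ := hU.subset_closedBall 0
  have hC0 : 0 ≤ C := (norm_nonneg _).trans (hC 0)
  have hle : ∀ n, ‖(w n).fst‖ ≤ C := fun n => by
    refine le_trans ?_ (hC n)
    refine (pow_le_pow_iff_left₀ (norm_nonneg _) (norm_nonneg _) two_ne_zero).1 ?_
    rw [Jet_norm_sq]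
    exact le_add_of_nonneg_right (Finset.sum_nonneg fun i _ => sq_nonneg _)
  obtain ⟨φ, hφ, hcau⟩ := exists_subseq_inner_cauchy (fun n => (w n).fst) hle
  refine ⟨φ, hφ, ?_⟩
  choose f hf hwf hwd using fun n => hw (φ n)
  set V := (volume (Metric.closedBall (0 : Space d) R)).toReal with hV
  set G : ℕ × ℕ → Space d → ℂ := fun p ξ => 𝓕 ((hf p.1).sub (hf p.2)).toSchwartz ξ with hG
  have hsub : ∀ p : ℕ × ℕ, (w (φ p.1) - w (φ p.2)).fst =ᵐ[volume] f p.1 - f p.2 := fun p =>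
    (Lp.coeFn_sub _ _).trans ((hwf p.1).sub (hwf p.2))
  have hsubd : ∀ (p : ℕ × ℕ) i, (w (φ p.1) - w (φ p.2)).snd i =ᵐ[volume]
      partialDeriv i (f p.1 - f p.2) := fun p i => by
    refine (Lp.coeFn_sub ((w (φ p.1)).snd i) ((w (φ p.2)).snd i)).trans
      (((hwd p.1 i).sub (hwd p.2 i)).trans (.of_forall fun x => ?_))
    have h1 : DifferentiableAt ℝ (f p.1) x := ((hf p.1).1.differentiable (by simp)) x
    have h2 : DifferentiableAt ℝ (f p.2) x := ((hf p.2).1.differentiable (by simp)) x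
    simp [partialDeriv, fderiv_sub h1 h2]
  have hGi : ∀ p ξ, G p ξ = inner ℂ (cutExpL2 R ξ) (w (φ p.1)).fst -
      inner ℂ (cutExpL2 R ξ) (w (φ p.2)).fst := fun p ξ => by
    rw [← inner_sub_right]
    exact fourier_eq_inner_cutExp _ hR (hsub p) ξ
  have hGb : ∀ p ξ, ‖G p ξ‖ ^ 2 ≤ V * (2 * C) ^ 2 := fun p ξ => by
    rw [hGi, ← inner_sub_right]
    have h1 := norm_inner_le_norm (𝕜 := ℂ) (cutExpL2 R ξ) ((w (φ p.1)).fst - (w (φ p.2)).fst)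
    have h2 : ‖(w (φ p.1)).fst - (w (φ p.2)).fst‖ ≤ 2 * C :=
      (norm_sub_le _ _).trans (by linarith [hle (φ p.1), hle (φ p.2)])
    calc _ ≤ (‖cutExpL2 R ξ‖ * ‖(w (φ p.1)).fst - (w (φ p.2)).fst‖) ^ 2 := by gcongr
      _ ≤ _ := by
        rw [mul_pow]
        gcongr
        exact norm_cutExpL2_le R ξ
  have hlim : ∀ r, Tendsto (fun p => ∫ ξ in Metric.ball (0 : Space d) r, ‖G p ξ‖ ^ 2)
      atTop (𝓝 0) := fun r => by
    have h0 : (∫ ξ in Metric.ball (0 : Space d) r, (0 : ℝ)) = 0 := by simp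
    rw [← h0]
    refine tendsto_integral_filter_of_dominated_convergence (fun _ => V * (2 * C) ^ 2)
      (.of_forall fun p => ?_) (.of_forall fun p => .of_forall fun ξ => ?_) ?_
      (.of_forall fun ξ => ?_)
    · exact (SchwartzMap_integrable_norm_sq _).aestronglyMeasurable.restrict
    · rw [Real.norm_eq_abs, abs_of_nonneg (sq_nonneg _)]
      exact hGb p ξ
    · exact integrableOn_const (Metric.isBounded_ball.measure_lt_top).ne
    · have h1 := cauchySeq_iff_tendsto_dist_atTop_0.1 (hcau (cutExpL2 R ξ))
      have h2 := h1.pow 2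
      simp only [ne_eq, OfNat.ofNat_ne_zero, not_false_eq_true, zero_pow] at h2
      refine h2.congr fun p => ?_
      rw [hGi, dist_eq_norm]
  rw [Metric.cauchySeq_iff]
  intro ε hε
  obtain ⟨r, hr, hrε⟩ : ∃ r : ℝ, 0 < r ∧ (r ^ 2)⁻¹ * (2 * C) ^ 2 < ε ^ 2 / 2 := by
    have h1 : Tendsto (fun r : ℝ => (r ^ 2)⁻¹ * (2 * C) ^ 2) atTop (𝓝 (0 * (2 * C) ^ 2)) :=
      ((tendsto_pow_atTop two_ne_zero).inv_tendsto_atTop).mul_const _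
    rw [zero_mul] at h1
    exact ((eventually_gt_atTop 0).and
      (h1.eventually_lt_const (show (0 : ℝ) < ε ^ 2 / 2 by positivity))).exists
  have h1 := (hlim r).eventually_lt_const (show (0 : ℝ) < ε ^ 2 / 2 by positivity)
  obtain ⟨N, hN⟩ := eventually_atTop.1 h1
  refine ⟨max N.1 N.2, fun m hm n hn => ?_⟩
  have h2 := hN (m, n) ⟨le_of_max_le_left hm, le_of_max_le_right hn⟩
  have h3 := norm_fst_sq_le_of_fourier ((hf m).sub (hf n)) (hsub (m, n)) (hsubd (m, n)) hr
  have h4 : ‖w (φ m) - w (φ n)‖ ≤ 2 * C :=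
    (norm_sub_le _ _).trans (by linarith [hC (φ m), hC (φ n)])
  have h5 : (r ^ 2)⁻¹ * ‖w (φ m) - w (φ n)‖ ^ 2 ≤ (r ^ 2)⁻¹ * (2 * C) ^ 2 := by gcongr
  rw [dist_eq_norm]
  refine lt_of_pow_lt_pow_left₀ 2 hε.le ?_
  calc ‖(w (φ m)).fst - (w (φ n)).fst‖ ^ 2 = ‖(w (φ m) - w (φ n)).fst‖ ^ 2 := rfl
    _ ≤ _ := h3
    _ < ε ^ 2 / 2 + ε ^ 2 / 2 := add_lt_add_of_lt_of_le h2 (h5.trans hrε.le)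
    _ = ε ^ 2 := by ring

/-- The embedding of `H^1_0(U)` into `L²` is compact. -/
theorem compactOn_H10 {U : Set (Space d)} (hU : Bornology.IsBounded U) :
    CompactOn (H10 U) (fstCLM d) := by
  rintro x hx ⟨C, hC⟩
  -- The errors tend to zero, so a Cauchy subsequence of the approximants gives one of the original
  -- sequence.
  have happ : ∀ n : ℕ, ∃ w ∈ testJets U, ‖x n - w‖ < 1 / ((n : ℝ) + 1) := fun n => by
    have h1 : x n ∈ closure (testJets U : Set (Jet d)) := hx n
    obtain ⟨w, hw, h⟩ := Metric.mem_closure_iff.1 h1 (1 / ((n : ℝ) + 1)) (by positivity)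
    exact ⟨w, hw, by rwa [← dist_eq_norm]⟩
  choose w hw hxw using happ
  have hb : ∀ n, ‖w n‖ ≤ C + 1 := fun n => by
    have h1 : ‖w n‖ ≤ ‖x n‖ + ‖x n - w n‖ := by
      have := norm_sub_le (x n) (x n - w n)
      rwa [sub_sub_cancel] at this
    have h2 : 1 / ((n : ℝ) + 1) ≤ 1 := by
      rw [div_le_one (by positivity)]
      linarith [(Nat.cast_nonneg n : (0 : ℝ) ≤ n)]
    linarith [hC n, hxw n]
  obtain ⟨φ, hφ, hcau⟩ := exists_subseq_cauchy_of_testJets hU w hw hb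
  refine ⟨φ, hφ, ?_⟩
  have h0 : Tendsto (fun n => x (φ n) - w (φ n)) atTop (𝓝 0) := by
    refine squeeze_zero_norm (fun n => (hxw (φ n)).le) ?_
    exact tendsto_one_div_add_atTop_nhds_zero_nat.comp hφ.tendsto_atTop
  have h1 : CauchySeq fun n => fstCLM d (x (φ n) - w (φ n)) :=
    (((fstCLM d).continuous.tendsto 0).comp h0).cauchySeq
  have h2 : (fun n => fstCLM d (x (φ n))) =
      (fun n => fstCLM d (x (φ n) - w (φ n))) + fun n => (w (φ n)).fst := by
    ext1 n
    rw [Pi.add_apply, map_sub]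
    simp
  rw [h2]
  exact h1.add hcau

end Rellich

/-! ### Kato's inequality for eigenfunctions of the Dirichlet Laplacian -/

section Kato

open Filter Topology

variable {d : ℕ}

/-- The standard basis vector. -/
abbrev basisVec (i : Fin d) : Space d := EuclideanSpace.single i 1

lemma exists_testJet {U : Set (Space d)} {f : Space d → ℂ} (hf : IsTest U f) :
    ∃ w ∈ testJets U, w.fst =ᵐ[volume] f ∧ ∀ i, w.snd i =ᵐ[volume] partialDeriv i f := by
  have h1 : MemLp f 2 volume := hf.1.continuous.memLp_of_hasCompactSupport hf.2.1
  have h2 : ∀ i, MemLp (partialDeriv i f) 2 volume := fun i => by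
    have hc : Continuous (partialDeriv i f) :=
      (hf.1.continuous_fderiv (by simp)).clm_apply continuous_const
    exact hc.memLp_of_hasCompactSupport (hf.2.1.fderiv_apply ℝ _)
  refine ⟨WithLp.toLp 2 (h1.toLp, WithLp.toLp 2 fun i => (h2 i).toLp),
    ⟨f, hf, h1.coeFn_toLp, fun i => (h2 i).coeFn_toLp⟩, h1.coeFn_toLp, fun i => (h2 i).coeFn_toLp⟩

lemma integral_norm_mul_norm_le (f g : L2 d) :
    Integrable (fun x => ‖f x‖ * ‖g x‖) ∧ ∫ x, ‖f x‖ * ‖g x‖ ≤ ‖f‖ * ‖g‖ := by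
  have hnorm : ∀ f : L2 d, (∫ x, ‖f x‖ ^ (2 : ℝ)) ^ (1 / (2 : ℝ)) = ‖f‖ := fun f => by
    have h2 := L2_norm_sq f
    simp only [Real.rpow_two]
    rw [← h2, ← Real.sqrt_eq_rpow, Real.sqrt_sq (norm_nonneg _)]
  refine ⟨(Lp.memLp f).norm.integrable_mul (Lp.memLp g).norm, ?_⟩
  have h := integral_mul_norm_le_Lp_mul_Lq (μ := (volume : Measure (Space d)))
    Real.HolderConjugate.two_two (f := f) (g := g) (by simpa using Lp.memLp f)
    (by simpa using Lp.memLp g)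
  rwa [hnorm, hnorm] at h

/-- The smooth approximation `√(|f|² + ε²)` of `|f|`. -/
def regNorm (ε : ℝ) (f : Space d → ℂ) (x : Space d) : ℝ := √(‖f x‖ ^ 2 + ε ^ 2)

lemma regNorm_sq (ε : ℝ) (f : Space d → ℂ) (x : Space d) :
    regNorm ε f x ^ 2 = ‖f x‖ ^ 2 + ε ^ 2 := Real.sq_sqrt (by positivity)

lemma regNorm_pos {ε : ℝ} (hε : 0 < ε) (f : Space d → ℂ) (x : Space d) : 0 < regNorm ε f x :=
  Real.sqrt_pos.2 (by positivity)

lemma norm_le_regNorm (ε : ℝ) (f : Space d → ℂ) (x : Space d) : ‖f x‖ ≤ regNorm ε f x :=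
  Real.le_sqrt_of_sq_le (by linarith [sq_nonneg ε])

lemma le_regNorm (ε : ℝ) (f : Space d → ℂ) (x : Space d) : ε ≤ regNorm ε f x :=
  Real.le_sqrt_of_sq_le (by linarith [sq_nonneg ‖f x‖])

lemma regNorm_le {ε : ℝ} (hε : 0 < ε) (f : Space d → ℂ) (x : Space d) :
    regNorm ε f x ≤ ‖f x‖ + ε :=
  Real.sqrt_le_iff.2 ⟨by positivity, by nlinarith [norm_nonneg (f x)]⟩

lemma contDiff_regNorm {ε : ℝ} (hε : 0 < ε) {f : Space d → ℂ}
    (hf : ContDiff ℝ ((⊤ : ℕ∞) : WithTop ℕ∞) f) :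
    ContDiff ℝ ((⊤ : ℕ∞) : WithTop ℕ∞) (regNorm ε f) := by
  unfold regNorm
  refine ContDiff.sqrt ((hf.norm_sq ℝ).add contDiff_const) fun x => ?_
  positivity

/-- Differentiate `regNorm ε f ^ 2 = ‖f‖ ^ 2 + ε ^ 2`. -/
lemma regNorm_mul_fderiv {ε : ℝ} (hε : 0 < ε) {f : Space d → ℂ}
    (hf : ContDiff ℝ ((⊤ : ℕ∞) : WithTop ℕ∞) f) (i : Fin d) (x : Space d) :
    regNorm ε f x * fderiv ℝ (regNorm ε f) x (basisVec i) =
      (conj (f x) * partialDeriv i f x).re := by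
  have hs : HasFDerivAt (regNorm ε f) (fderiv ℝ (regNorm ε f) x) x :=
    ((contDiff_regNorm hε hf).differentiable (by simp) x).hasFDerivAt
  have hf' : HasFDerivAt f (fderiv ℝ f x) x := (hf.differentiable (by simp) x).hasFDerivAt
  have h1 := hs.pow 2
  have h2 := (hf'.norm_sq).add_const (ε ^ 2)
  have h3 : (fun x => regNorm ε f x ^ 2) = fun x => ‖f x‖ ^ 2 + ε ^ 2 :=
    funext (regNorm_sq ε f)
  rw [← h3] at h2
  have h4 := congrArg (fun L => L (basisVec i)) (h1.unique h2)
  simp only [_root_.smul_apply, ContinuousLinearMap.comp_apply,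
    innerSL_apply_apply, smul_eq_mul] at h4
  have h5 : inner ℝ (f x) (fderiv ℝ f x (basisVec i)) =
      (conj (f x) * partialDeriv i f x).re := by
    rw [Complex.inner]
    simp only [partialDeriv]
    rw [mul_comm]
  rw [h5] at h4
  have h6 : 2 * regNorm ε f x * fderiv ℝ (regNorm ε f) x (basisVec i) =
      2 * (conj (f x) * partialDeriv i f x).re := by
    simpa [mul_add] using h4
  linarith

/-- The pointwise core of Kato's inequality, with `z`, `p`, `s`, `ds` standing for $f$, $\partial_i
f$, $\sqrt{|f|^2+\varepsilon^2}$ and its derivative. The two sides of the first claim differ by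
$\tfrac gs(|p|^2-ds^2)$, which is nonnegative because $|ds|\le|p|$. The second claim bounds the
derivative of the test function $gf/s$. -/
lemma kato_scalar {z p : ℂ} {s ds g dg ε B : ℝ} (hε : 0 < ε) (hεs : ε ≤ s) (hzs : ‖z‖ ≤ s)
    (hs : s * ds = (conj z * p).re) (hg : 0 ≤ g) (hgB : g ≤ B) (hdB : |dg| ≤ B) :
    dg * ds ≤ (conj ((g / s : ℝ) * p + ((dg * s - g * ds) / s ^ 2 : ℝ) * z) * p).re ∧
    ‖(g / s : ℝ) * p + ((dg * s - g * ds) / s ^ 2 : ℝ) * z‖ ≤ B / ε * (‖z‖ + 2 * ‖p‖) := by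
  have hs0 : 0 < s := hε.trans_le hεs
  have hB : 0 ≤ B := hg.trans hgB
  have hds : |ds| ≤ ‖p‖ := by
    have h1 : |s * ds| ≤ ‖z‖ * ‖p‖ := by
      rw [hs]
      refine (Complex.abs_re_le_norm _).trans ?_
      rw [norm_mul, RCLike.norm_conj]
    rw [abs_mul, abs_of_pos hs0] at h1
    have h2 : ‖z‖ * ‖p‖ ≤ s * ‖p‖ := by gcongr
    exact le_of_mul_le_mul_left (h1.trans h2) hs0
  have hds2 : ds ^ 2 ≤ ‖p‖ ^ 2 := by
    rw [← sq_abs]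
    gcongr
  constructor
  · have h1 : (conj ((g / s : ℝ) * p + ((dg * s - g * ds) / s ^ 2 : ℝ) * z) * p).re =
        g / s * ‖p‖ ^ 2 + (dg * s - g * ds) / s ^ 2 * (conj z * p).re := by
      simp only [map_add, map_mul, Complex.conj_ofReal, add_mul, mul_assoc, Complex.add_re,
        Complex.re_ofReal_mul, Complex.conj_mul']
      norm_cast
    rw [h1, ← hs]
    have h2 : g / s * ‖p‖ ^ 2 + (dg * s - g * ds) / s ^ 2 * (s * ds) =
        dg * ds + g / s * (‖p‖ ^ 2 - ds ^ 2) := by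
      field_simp
      ring
    rw [h2]
    have h3 : 0 ≤ g / s * (‖p‖ ^ 2 - ds ^ 2) :=
      mul_nonneg (div_nonneg hg hs0.le) (sub_nonneg.2 hds2)
    linarith
  · refine (norm_add_le _ _).trans ?_
    rw [norm_mul, norm_mul, Complex.norm_real, Complex.norm_real, Real.norm_eq_abs,
      Real.norm_eq_abs, abs_of_nonneg (div_nonneg hg hs0.le)]
    have h1 : g / s ≤ B / ε := div_le_div₀ hB hgB hε hεs
    have h2 : |(dg * s - g * ds) / s ^ 2| * ‖z‖ ≤ B / ε * ‖z‖ + B / ε * ‖p‖ := by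
      have e1 : (dg * s - g * ds) / s ^ 2 = dg / s - g / s * (ds / s) := by
        field_simp
      have e2 : |dg / s| ≤ B / ε := by
        rw [abs_div, abs_of_pos hs0]
        exact div_le_div₀ hB hdB hε hεs
      have e3 : |ds / s| * ‖z‖ ≤ ‖p‖ := by
        rw [abs_div, abs_of_pos hs0, div_mul_eq_mul_div, div_le_iff₀ hs0]
        gcongr
      calc |(dg * s - g * ds) / s ^ 2| * ‖z‖ ≤ (|dg / s| + g / s * |ds / s|) * ‖z‖ := by
            rw [e1]
            gcongr
            refine (abs_sub _ _).trans ?_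
            rw [abs_mul, abs_of_nonneg (div_nonneg hg hs0.le)]
        _ = |dg / s| * ‖z‖ + g / s * (|ds / s| * ‖z‖) := by ring
        _ ≤ B / ε * ‖z‖ + B / ε * ‖p‖ := by gcongr
    have h3 : g / s * ‖p‖ ≤ B / ε * ‖p‖ := by gcongr
    linarith

/-- The test function `g f / √(|f|² + ε²)`. -/
def katoTest (ε : ℝ) (g : Space d → ℝ) (f : Space d → ℂ) (x : Space d) : ℂ :=
  ((g x / regNorm ε f x : ℝ) : ℂ) * f x

lemma contDiff_katoTest {f : Space d → ℂ} (hf : ContDiff ℝ ((⊤ : ℕ∞) : WithTop ℕ∞) f)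
    {ε : ℝ} (hε : 0 < ε) {g : Space d → ℝ} (hg : ContDiff ℝ ((⊤ : ℕ∞) : WithTop ℕ∞) g) :
    ContDiff ℝ ((⊤ : ℕ∞) : WithTop ℕ∞) (katoTest ε g f) :=
  (Complex.ofRealCLM.contDiff.comp
    (hg.div (contDiff_regNorm hε hf) fun x => (regNorm_pos hε f x).ne')).mul hf

lemma isTest_katoTest {U : Set (Space d)} {f : Space d → ℂ} (hf : IsTest U f) {ε : ℝ} (hε : 0 < ε)
    {g : Space d → ℝ} (hg : ContDiff ℝ ((⊤ : ℕ∞) : WithTop ℕ∞) g) :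
    IsTest U (katoTest ε g f) := by
  exact ⟨contDiff_katoTest hf.1 hε hg, hf.2.1.mul_left, (tsupport_mul_subset_right).trans hf.2.2⟩

lemma partialDeriv_katoTest {f : Space d → ℂ} (hf : ContDiff ℝ ((⊤ : ℕ∞) : WithTop ℕ∞) f)
    {ε : ℝ} (hε : 0 < ε) {g : Space d → ℝ} (hg : ContDiff ℝ ((⊤ : ℕ∞) : WithTop ℕ∞) g)
    (i : Fin d) (x : Space d) :
    partialDeriv i (katoTest ε g f) x =
      ((g x / regNorm ε f x : ℝ) : ℂ) * partialDeriv i f x +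
      (((fderiv ℝ g x (basisVec i) * regNorm ε f x -
        g x * fderiv ℝ (regNorm ε f) x (basisVec i)) / regNorm ε f x ^ 2 : ℝ) : ℂ) * f x := by
  have hs : HasDerivAt (fun t : ℝ => regNorm ε f (x + t • basisVec i)) _ 0 :=
    ((contDiff_regNorm hε hf).differentiable (by simp) x).hasFDerivAt.hasLineDerivAt (basisVec i)
  have hf' : HasDerivAt (fun t : ℝ => f (x + t • basisVec i)) _ 0 :=
    (hf.differentiable (by simp) x).hasFDerivAt.hasLineDerivAt (basisVec i)
  have hg' : HasDerivAt (fun t : ℝ => g (x + t • basisVec i)) _ 0 :=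
    (hg.differentiable (by simp) x).hasFDerivAt.hasLineDerivAt (basisVec i)
  have hk : HasDerivAt (fun t : ℝ => katoTest ε g f (x + t • basisVec i)) _ 0 :=
    ((contDiff_katoTest hf hε hg).differentiable (by simp) x).hasFDerivAt.hasLineDerivAt
      (basisVec i)
  have h1 := (hg'.fun_div hs (regNorm_pos hε f _).ne').ofReal_comp.fun_mul hf'
  have h2 := hk.unique h1
  simp only [zero_smul, add_zero] at h2
  rw [partialDeriv, h2, partialDeriv]
  ring

lemma continuous_partialDeriv {f : Space d → ℂ} (hf : ContDiff ℝ ((⊤ : ℕ∞) : WithTop ℕ∞) f)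
    (i : Fin d) : Continuous (partialDeriv i f) :=
  (hf.continuous_fderiv (by simp)).clm_apply continuous_const

lemma contDiff_fderiv_basisVec {g : Space d → ℝ} (hg : ContDiff ℝ ((⊤ : ℕ∞) : WithTop ℕ∞) g)
    (i : Fin d) :
    ContDiff ℝ ((⊤ : ℕ∞) : WithTop ℕ∞) fun x => fderiv ℝ g x (basisVec i) :=
  (hg.fderiv_right (by simp)).clm_apply contDiff_const

/-- Subtracting the value `ε` taken off the support of `f` permits integration by parts against a
`g` without compact support. -/
lemma hasCompactSupport_regNorm_sub {ε : ℝ} (hε : 0 < ε) {f : Space d → ℂ}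
    (hf : HasCompactSupport f) : HasCompactSupport fun x => regNorm ε f x - ε := by
  refine hf.mono fun x hx => ?_
  contrapose! hx
  have h0 : f x = 0 := by simpa using hx
  simp [regNorm, h0, Real.sqrt_sq hε.le]

/-- The integrated form of Kato's inequality for a test function. -/
lemma kato_test {U : Set (Space d)} {f : Space d → ℂ} (hf : IsTest U f) {ε B : ℝ} (hε : 0 < ε)
    {g h : Space d → ℝ} (hg : ContDiff ℝ ((⊤ : ℕ∞) : WithTop ℕ∞) g) (hg0 : ∀ x, 0 ≤ g x)
    (hgB : ∀ x, g x ≤ B) (hdB : ∀ i x, |fderiv ℝ g x (basisVec i)| ≤ B)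
    (hh : ∀ x, h x = ∑ i, fderiv ℝ (fun y => fderiv ℝ g y (basisVec i)) x (basisVec i))
    {w k : Jet d} (hwd : ∀ i, w.snd i =ᵐ[volume] partialDeriv i f)
    (hkd : ∀ i, k.snd i =ᵐ[volume] partialDeriv i (katoTest ε g f)) :
    -∫ x, h x * (regNorm ε f x - ε) ≤ (inner ℂ k.snd w.snd).re := by
  have hkt := isTest_katoTest hf hε hg
  have hsd := contDiff_regNorm hε hf.1
  have hsc := hasCompactSupport_regNorm_sub hε hf.2.1
  have hsfd : ∀ i x, fderiv ℝ (fun x => regNorm ε f x - ε) x (basisVec i) =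
      fderiv ℝ (regNorm ε f) x (basisVec i) := fun i x => by rw [fderiv_sub_const]
  have hsdc : ∀ i, HasCompactSupport fun x => fderiv ℝ (regNorm ε f) x (basisVec i) := fun i => by
    simp only [← hsfd]
    exact hsc.fderiv_apply ℝ _
  have hgc := fun i => (contDiff_fderiv_basisVec hg i)
  have hggc := fun i => (contDiff_fderiv_basisVec (hgc i) i).continuous
  have hI1 : ∀ i, Integrable fun x =>
      fderiv ℝ g x (basisVec i) * fderiv ℝ (regNorm ε f) x (basisVec i) := fun i =>
    ((hgc i).continuous.mul (contDiff_fderiv_basisVec hsd i).continuous).integrable_of_hasCompactSupport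
      (hsdc i).mul_left
  have hI2 : ∀ i, Integrable fun x =>
      fderiv ℝ (fun y => fderiv ℝ g y (basisVec i)) x (basisVec i) * (regNorm ε f x - ε) := fun i =>
    ((hggc i).mul (hsd.continuous.sub continuous_const)).integrable_of_hasCompactSupport hsc.mul_left
  have hI3 : ∀ i, Integrable fun x => fderiv ℝ g x (basisVec i) * (regNorm ε f x - ε) := fun i =>
    ((hgc i).continuous.mul (hsd.continuous.sub continuous_const)).integrable_of_hasCompactSupport
      hsc.mul_left
  have hI4 : ∀ i, Integrable fun x => conj (partialDeriv i (katoTest ε g f) x) *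
      partialDeriv i f x := fun i =>
    ((Complex.continuous_conj.comp (continuous_partialDeriv hkt.1 i)).mul
      (continuous_partialDeriv hf.1 i)).integrable_of_hasCompactSupport
      (hf.2.1.fderiv_apply ℝ _).mul_left
  have hparts : ∀ i, ∫ x, fderiv ℝ g x (basisVec i) * fderiv ℝ (regNorm ε f) x (basisVec i) =
      -∫ x, fderiv ℝ (fun y => fderiv ℝ g y (basisVec i)) x (basisVec i) *
        (regNorm ε f x - ε) := fun i => by
    have h1 := integral_mul_fderiv_eq_neg_fderiv_mul_of_integrable
      (f := fun x => fderiv ℝ g x (basisVec i)) (g := fun x => regNorm ε f x - ε)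
      (v := basisVec i) (μ := (volume : Measure (Space d))) (hI2 i)
      (by simpa only [hsfd] using hI1 i) (hI3 i)
      (fun x _ => (hgc i).differentiable (by simp) x)
      (fun x _ => (hsd.differentiable (by simp) x).sub_const ε)
    simpa only [hsfd] using h1
  have hL : -∫ x, h x * (regNorm ε f x - ε) =
      ∑ i, ∫ x, fderiv ℝ g x (basisVec i) * fderiv ℝ (regNorm ε f) x (basisVec i) := by
    simp only [hparts, hh, Finset.sum_mul, Finset.sum_neg_distrib]
    rw [integral_finsetSum _ fun i _ => hI2 i]
  rw [hL, PiLp.inner_apply, Complex.re_sum]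
  refine Finset.sum_le_sum fun i _ => ?_
  have h1 : inner ℂ (k.snd i) (w.snd i) =
      ∫ x, conj (partialDeriv i (katoTest ε g f) x) * partialDeriv i f x := by
    rw [L2_inner]
    refine integral_congr_ae ?_
    filter_upwards [hwd i, hkd i] with x h1 h2
    rw [h1, h2]
  have h2 : (∫ x, conj (partialDeriv i (katoTest ε g f) x) * partialDeriv i f x).re =
      ∫ x, (conj (partialDeriv i (katoTest ε g f) x) * partialDeriv i f x).re :=
    (integral_re (hI4 i)).symm
  change _ ≤ (inner ℂ (k.snd i) (w.snd i)).re
  rw [h1, h2]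
  refine integral_mono (hI1 i) (hI4 i).re fun x => ?_
  change _ ≤ (conj (partialDeriv i (katoTest ε g f) x) * partialDeriv i f x).re
  rw [partialDeriv_katoTest hf.1 hε hg]
  exact (kato_scalar hε (le_regNorm ε f x) (norm_le_regNorm ε f x) (regNorm_mul_fderiv hε hf.1 i x)
    (hg0 x) (hgB x) (hdB i x)).1

lemma norm_katoTest_le {ε B : ℝ} (hε : 0 < ε) {g : Space d → ℝ} (hg0 : ∀ x, 0 ≤ g x)
    (hgB : ∀ x, g x ≤ B) (f : Space d → ℂ) (x : Space d) :
    ‖katoTest ε g f x‖ ≤ g x ∧ ‖katoTest ε g f x‖ ≤ B / ε * ‖f x‖ := by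
  have hs := regNorm_pos hε f x
  have hB : 0 ≤ B := (hg0 x).trans (hgB x)
  rw [katoTest, norm_mul, Complex.norm_real, Real.norm_eq_abs, abs_of_nonneg
    (div_nonneg (hg0 x) hs.le)]
  constructor
  · rw [div_mul_eq_mul_div, div_le_iff₀ hs]
    exact mul_le_mul_of_nonneg_left (norm_le_regNorm ε f x) (hg0 x)
  · gcongr
    · exact hgB x
    · exact le_regNorm ε f x

/-- For fixed `ε`, this keeps the Kato test functions of approximants `w → φ` bounded, so replacing
`w` by `φ` costs a multiple of `‖w - φ‖`. The constants come from $(a+2b)^2\le 2a^2+8b^2$, summed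
over `d` directions. -/
lemma norm_sq_katoJet_le {f : Space d → ℂ} (hf : ContDiff ℝ ((⊤ : ℕ∞) : WithTop ℕ∞) f) {ε B : ℝ}
    (hε : 0 < ε) {g : Space d → ℝ} (hg : ContDiff ℝ ((⊤ : ℕ∞) : WithTop ℕ∞) g)
    (hg0 : ∀ x, 0 ≤ g x) (hgB : ∀ x, g x ≤ B) (hdB : ∀ i x, |fderiv ℝ g x (basisVec i)| ≤ B)
    {w k : Jet d} (hwf : w.fst =ᵐ[volume] f) (hwd : ∀ i, w.snd i =ᵐ[volume] partialDeriv i f)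
    (hkd : ∀ i, k.snd i =ᵐ[volume] partialDeriv i (katoTest ε g f)) :
    ‖k.snd‖ ^ 2 ≤ (B / ε) ^ 2 * (2 * d + 8) * ‖w‖ ^ 2 := by
  have hint : ∀ F : L2 d, Integrable fun x => ‖F x‖ ^ 2 := fun F =>
    (Lp.memLp F).integrable_norm_pow (by norm_num)
  have h1 : ∀ i, ‖k.snd i‖ ^ 2 ≤ (B / ε) ^ 2 * (2 * ‖w.fst‖ ^ 2 + 8 * ‖w.snd i‖ ^ 2) := fun i => by
    rw [L2_norm_sq, L2_norm_sq, L2_norm_sq, ← integral_const_mul, ← integral_const_mul,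
      ← integral_add ((hint _).const_mul _) ((hint _).const_mul _), ← integral_const_mul]
    refine integral_mono_ae (hint _)
      ((((hint _).const_mul _).add ((hint _).const_mul _)).const_mul _) ?_
    filter_upwards [hwf, hwd i, hkd i] with x h1 h2 h3
    rw [h1, h2, h3, partialDeriv_katoTest hf hε hg]
    have h4 := (kato_scalar hε (le_regNorm ε f x) (norm_le_regNorm ε f x)
      (regNorm_mul_fderiv hε hf i x) (hg0 x) (hgB x) (hdB i x)).2
    calc _ ≤ (B / ε * (‖f x‖ + 2 * ‖partialDeriv i f x‖)) ^ 2 := by gcongr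
      _ ≤ _ := by
        rw [mul_pow]
        gcongr
        nlinarith [sq_nonneg (‖f x‖ - 2 * ‖partialDeriv i f x‖)]
  rw [PiLp.norm_sq_eq_of_L2]
  refine (Finset.sum_le_sum fun i _ => h1 i).trans ?_
  rw [← Finset.mul_sum, Finset.sum_add_distrib, ← Finset.mul_sum, Jet_norm_sq w, mul_assoc]
  gcongr
  simp only [Finset.sum_const, Finset.card_univ, Fintype.card_fin, nsmul_eq_mul, ← Finset.mul_sum]
  have h5 : 0 ≤ ∑ i, ‖w.snd i‖ ^ 2 := Finset.sum_nonneg fun i _ => sq_nonneg _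
  nlinarith [sq_nonneg ‖w.fst‖, mul_nonneg (Nat.cast_nonneg (α := ℝ) d) h5]

lemma norm_snd_le (w : Jet d) : ‖w.snd‖ ≤ ‖w‖ := by
  refine (pow_le_pow_iff_left₀ (norm_nonneg _) (norm_nonneg _) two_ne_zero).1 ?_
  rw [WithLp.prod_norm_sq_eq_of_L2]
  linarith [sq_nonneg ‖w.fst‖]

lemma norm_fst_le (w : Jet d) : ‖w.fst‖ ≤ ‖w‖ := by
  refine (pow_le_pow_iff_left₀ (norm_nonneg _) (norm_nonneg _) two_ne_zero).1 ?_
  rw [WithLp.prod_norm_sq_eq_of_L2]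
  linarith [sq_nonneg ‖w.snd‖]

lemma schrodingerForm_zero (χ ψ : Jet d) :
    schrodingerForm (fun _ => 0) χ ψ = inner ℂ χ.snd ψ.snd := by
  rw [schrodingerForm, PiLp.inner_apply]
  simp only [Complex.ofReal_zero, zero_mul, integral_zero, add_zero]
  exact Finset.sum_congr rfl fun i _ => (L2_inner _ _).symm

/-- The Kato test function of the approximant `w` is itself a test function in `U`, hence admissible
in the eigenvalue equation of `φ`, and its modulus is at most `g`. The error terms come from `ε` and
from replacing `w` by `φ`. -/
lemma kato_approx {U : Set (Space d)} {l : ℝ} (hl : 0 ≤ l) {φ : Jet d}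
    (hφ : IsEigenfunction U (fun _ => 0) l φ) (hφ1 : Integrable φ.fst)
    {ε B : ℝ} (hε : 0 < ε)
    {g h : Space d → ℝ} (hg : ContDiff ℝ ((⊤ : ℕ∞) : WithTop ℕ∞) g) (hg0 : ∀ x, 0 ≤ g x)
    (hgB : ∀ x, g x ≤ B) (hdB : ∀ i x, |fderiv ℝ g x (basisVec i)| ≤ B)
    (hh : ∀ x, h x = ∑ i, fderiv ℝ (fun y => fderiv ℝ g y (basisVec i)) x (basisVec i))
    (hh1 : Integrable h) {H : L2 d} (hH : H =ᵐ[volume] fun x => (h x : ℂ))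
    {w : Jet d} (hw : w ∈ testJets U) :
    -∫ x, h x * ‖φ.fst x‖ ≤ l * (∫ x, g x * ‖φ.fst x‖) + ε * (∫ x, |h x|) +
      ‖H‖ * ‖w - φ‖ + √((B / ε) ^ 2 * (2 * d + 8) * ‖w‖ ^ 2) * ‖w - φ‖ := by
  obtain ⟨f, hf, hwf, hwd⟩ := hw
  obtain ⟨k, hk, hkf, hkd⟩ := exists_testJet (isTest_katoTest hf hε hg)
  have hB : 0 ≤ B := (hg0 0).trans (hgB 0)
  have h1 := kato_test hf hε hg hg0 hgB hdB hh hwd hkd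
  have h2 : (inner ℂ k.snd w.snd).re ≤ (inner ℂ k.snd φ.snd).re +
      √((B / ε) ^ 2 * (2 * d + 8) * ‖w‖ ^ 2) * ‖w - φ‖ := by
    have e1 : inner ℂ k.snd w.snd = inner ℂ k.snd φ.snd + inner ℂ k.snd (w - φ).snd := by
      rw [← inner_add_right]
      congr 1
      simp
    have e2 : ‖k.snd‖ ≤ √((B / ε) ^ 2 * (2 * d + 8) * ‖w‖ ^ 2) :=
      Real.le_sqrt_of_sq_le (norm_sq_katoJet_le hf.1 hε hg hg0 hgB hdB hwf hwd hkd)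
    rw [e1, Complex.add_re]
    gcongr
    refine (Complex.re_le_norm _).trans ((norm_inner_le_norm _ _).trans ?_)
    gcongr
    exact norm_snd_le _
  have h3 : (inner ℂ k.snd φ.snd).re ≤ l * ∫ x, g x * ‖φ.fst x‖ := by
    have e1 := hφ.2.2 k (Submodule.le_topologicalClosure _ hk)
    rw [schrodingerForm_zero] at e1
    rw [e1, Complex.re_ofReal_mul]
    gcongr
    refine (Complex.re_le_norm _).trans ((norm_integral_le_integral_norm _).trans ?_)
    have hgm : Integrable fun x => g x * ‖φ.fst x‖ :=
      hφ1.norm.bdd_mul (c := B) hg.continuous.aestronglyMeasurable (.of_forall fun x => by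
        rw [Real.norm_eq_abs, abs_of_nonneg (hg0 x)]; exact hgB x)
    refine integral_mono_of_nonneg (.of_forall fun x => norm_nonneg _) hgm ?_
    filter_upwards [hkf] with x hx
    rw [norm_mul, RCLike.norm_conj, hx]
    gcongr
    exact (norm_katoTest_le hε hg0 hgB f x).1
  have hhc : Continuous h := by
    rw [funext hh]
    exact continuous_finsetSum _ fun i _ =>
      (contDiff_fderiv_basisVec (contDiff_fderiv_basisVec hg i) i).continuous
  have hI1 : Integrable fun x => h x * (regNorm ε f x - ε) :=
    (hhc.mul ((contDiff_regNorm hε hf.1).continuous.sub continuous_const)).integrable_of_hasCompactSupport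
      (hasCompactSupport_regNorm_sub hε hf.2.1).mul_left
  have hHn : ∀ G : L2 d, Integrable (fun x => |h x| * ‖G x‖) ∧
      ∫ x, |h x| * ‖G x‖ ≤ ‖H‖ * ‖G‖ := fun G => by
    have e1 : (fun x => ‖H x‖ * ‖G x‖) =ᵐ[volume] fun x => |h x| * ‖G x‖ :=
      hH.mono fun x hx => by simp only [hx, Complex.norm_real, Real.norm_eq_abs]
    have e2 := integral_norm_mul_norm_le H G
    rw [integral_congr_ae e1] at e2
    exact ⟨e2.1.congr e1, e2.2⟩
  have hI2 : Integrable fun x => h x * ‖φ.fst x‖ := by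
    refine (hHn φ.fst).1.mono (hhc.aestronglyMeasurable.mul hφ1.norm.aestronglyMeasurable)
      (.of_forall fun x => ?_)
    simp
  have h4 : -∫ x, h x * ‖φ.fst x‖ ≤ -(∫ x, h x * (regNorm ε f x - ε)) +
      (ε * (∫ x, |h x|) + ‖H‖ * ‖w - φ‖) := by
    have e1 := (hHn (w - φ).fst).2
    have e2 : ∫ x, (h x * (regNorm ε f x - ε) - h x * ‖φ.fst x‖) ≤
        ∫ x, (ε * |h x| + |h x| * ‖(w - φ).fst x‖) := by
      refine integral_mono_ae (hI1.sub hI2) ((hh1.abs.const_mul ε).add (hHn _).1) ?_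
      filter_upwards [hwf, Lp.coeFn_sub w.fst φ.fst] with x hx hx2
      have e3 : ‖(w - φ).fst x‖ = ‖f x - φ.fst x‖ := by
        rw [WithLp.sub_fst, hx2, Pi.sub_apply, hx]
      rw [e3, ← mul_sub, ← mul_comm |h x| ε, ← mul_add]
      refine (le_abs_self _).trans ?_
      rw [abs_mul]
      gcongr
      have e4 := regNorm_le hε f x
      have e5 := norm_le_regNorm ε f x
      have e6 := norm_sub_norm_le (f x) (φ.fst x)
      have e7 := norm_sub_norm_le (φ.fst x) (f x)
      rw [norm_sub_rev] at e7
      rw [abs_le]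
      constructor <;> linarith
    rw [integral_sub hI1 hI2, integral_add (hh1.abs.const_mul ε) (hHn _).1,
      integral_const_mul] at e2
    have e3 : ‖H‖ * ‖(w - φ).fst‖ ≤ ‖H‖ * ‖w - φ‖ := by
      gcongr
      exact norm_fst_le _
    linarith
  linarith

/-- Kato's inequality `-Δ|φ| ≤ l |φ|`, tested with a nonnegative function `g` with Laplacian `h`. -/
theorem kato_inequality {U : Set (Space d)} {l : ℝ} (hl : 0 ≤ l) {φ : Jet d}
    (hφ : IsEigenfunction U (fun _ => 0) l φ) (hφ1 : Integrable φ.fst) {B : ℝ}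
    {g h : Space d → ℝ} (hg : ContDiff ℝ ((⊤ : ℕ∞) : WithTop ℕ∞) g) (hg0 : ∀ x, 0 ≤ g x)
    (hgB : ∀ x, g x ≤ B) (hdB : ∀ i x, |fderiv ℝ g x (basisVec i)| ≤ B)
    (hh : ∀ x, h x = ∑ i, fderiv ℝ (fun y => fderiv ℝ g y (basisVec i)) x (basisVec i))
    (hh1 : Integrable h) (hh2 : MemLp h 2 volume) :
    -∫ x, h x * ‖φ.fst x‖ ≤ l * ∫ x, g x * ‖φ.fst x‖ := by
  have hH := hh2.ofReal (K := ℂ)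
  obtain ⟨w, hw, hlim⟩ := mem_closure_iff_seq_limit.1 (show φ ∈ closure (testJets U : Set (Jet d))
    from hφ.1)
  -- The limits do not commute: the error constant contains `B / ε`, so `w → φ` comes first and `ε →
  -- 0` after it.
  have hε : ∀ ε : ℝ, 0 < ε → -∫ x, h x * ‖φ.fst x‖ ≤
      l * (∫ x, g x * ‖φ.fst x‖) + ε * ∫ x, |h x| := fun ε hε => by
    have h1 := fun n => kato_approx hl hφ hφ1 hε hg hg0 hgB hdB hh hh1 hH.coeFn_toLp (hw n)
    have h0 : Tendsto (fun n => ‖w n - φ‖) atTop (𝓝 0) := by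
      rw [← tendsto_iff_norm_sub_tendsto_zero]
      exact hlim
    have h2 := (((tendsto_const_nhds (x := l * (∫ x, g x * ‖φ.fst x‖) + ε * ∫ x, |h x|)).add
      (h0.const_mul ‖hH.toLp‖)).add ((((hlim.norm.pow 2).const_mul
        ((B / ε) ^ 2 * (2 * d + 8))).sqrt).mul h0))
    simp only [mul_zero, add_zero] at h2
    exact ge_of_tendsto' h2 h1
  have h3 : Tendsto (fun ε : ℝ => l * (∫ x, g x * ‖φ.fst x‖) + ε * ∫ x, |h x|) (𝓝[>] 0)
      (𝓝 (l * (∫ x, g x * ‖φ.fst x‖) + 0 * ∫ x, |h x|)) :=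
    (tendsto_const_nhds.add (tendsto_id.mul_const _)).mono_left nhdsWithin_le_nhds
  rw [zero_mul, add_zero] at h3
  exact ge_of_tendsto h3 (eventually_mem_nhdsWithin.mono fun ε h => hε ε h)

end Kato

/-! ### The heat kernel bound for eigenfunctions of the Dirichlet Laplacian -/

section HeatKernel

open Filter Topology

variable {d : ℕ}

/-- The Gaussian `exp(-b|y-a|²)`. -/
def gauss (b : ℝ) (a y : Space d) : ℝ := Real.exp (-b * ‖y - a‖ ^ 2)

lemma gauss_pos (b : ℝ) (a y : Space d) : 0 < gauss b a y := Real.exp_pos _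

lemma gauss_le_one {b : ℝ} (hb : 0 ≤ b) (a y : Space d) : gauss b a y ≤ 1 :=
  Real.exp_le_one_iff.2 (by nlinarith [sq_nonneg ‖y - a‖])

lemma contDiff_gauss (b : ℝ) (a : Space d) :
    ContDiff ℝ ((⊤ : ℕ∞) : WithTop ℕ∞) (gauss b a) := by
  unfold gauss
  exact (contDiff_const.mul ((contDiff_id.sub contDiff_const).norm_sq ℝ)).exp

lemma continuous_gauss (b : ℝ) (a : Space d) : Continuous (gauss b a) :=
  (contDiff_gauss b a).continuous

lemma fderiv_gauss (b : ℝ) (a y : Space d) (i : Fin d) :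
    fderiv ℝ (gauss b a) y (basisVec i) = -(2 * b) * (y i - a i) * gauss b a y := by
  have h1 : HasFDerivAt (gauss b a) _ y :=
    ((((hasFDerivAt_id y).sub_const a).norm_sq).const_mul (-b)).exp
  rw [h1.fderiv]
  simp [gauss, EuclideanSpace.inner_single_right]
  ring

lemma fderiv_fderiv_gauss (b : ℝ) (a y : Space d) (i : Fin d) :
    fderiv ℝ (fun x => fderiv ℝ (gauss b a) x (basisVec i)) y (basisVec i) =
      (4 * b ^ 2 * (y i - a i) ^ 2 - 2 * b) * gauss b a y := by
  have h1 : HasFDerivAt (fun x : Space d => -(2 * b) * (x i - a i)) _ y :=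
    (((EuclideanSpace.proj (𝕜 := ℝ) i : Space d →L[ℝ] ℝ).hasFDerivAt).sub_const (a i)).const_mul
      (-(2 * b))
  have h2 : HasFDerivAt (gauss b a) (fderiv ℝ (gauss b a) y) y :=
    ((contDiff_gauss b a).differentiable (by simp) y).hasFDerivAt
  simp only [fderiv_gauss]
  rw [(h1.fun_mul h2).fderiv]
  simp [fderiv_gauss]
  ring

/-- The Laplacian of the Gaussian. -/
def gaussLap (b : ℝ) (a y : Space d) : ℝ := (4 * b ^ 2 * ‖y - a‖ ^ 2 - 2 * b * d) * gauss b a y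

lemma gaussLap_eq_sum (b : ℝ) (a y : Space d) : gaussLap b a y =
    ∑ i, fderiv ℝ (fun x => fderiv ℝ (gauss b a) x (basisVec i)) y (basisVec i) := by
  simp only [fderiv_fderiv_gauss, ← Finset.sum_mul, Finset.sum_sub_distrib, ← Finset.mul_sum,
    gaussLap, EuclideanSpace.norm_sq_eq]
  congr 1
  simp
  ring

lemma mul_exp_neg_le_one (x : ℝ) : x * Real.exp (-x) ≤ 1 := by
  rw [Real.exp_neg, ← div_eq_mul_inv, div_le_one (Real.exp_pos x)]
  linarith [Real.add_one_le_exp x]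

lemma sq_mul_gauss_le {b : ℝ} (hb : 0 < b) (a y : Space d) :
    ‖y - a‖ ^ 2 * gauss b a y ≤ 1 / b := by
  rw [le_div_iff₀ hb]
  have := mul_exp_neg_le_one (b * ‖y - a‖ ^ 2)
  rw [← neg_mul] at this
  simp only [gauss]
  linarith

lemma abs_fderiv_gauss_le {b : ℝ} (hb : 0 < b) (a y : Space d) (i : Fin d) :
    |fderiv ℝ (gauss b a) y (basisVec i)| ≤ 1 + b := by
  have h1 : (y i - a i) ^ 2 ≤ ‖y - a‖ ^ 2 := by
    rw [EuclideanSpace.norm_sq_eq]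
    have := Finset.single_le_sum (f := fun j => ‖(y - a) j‖ ^ 2) (fun j _ => sq_nonneg _)
      (Finset.mem_univ i)
    simpa using this
  have h2 := sq_mul_gauss_le hb a y
  have h3 := gauss_pos b a y
  rw [le_div_iff₀ hb] at h2
  rw [fderiv_gauss, abs_mul, abs_of_pos h3, abs_mul, abs_neg, abs_of_pos (by positivity)]
  have h4 : 2 * b * |y i - a i| ≤ b * ‖y - a‖ ^ 2 + b := by
    rw [← sq_abs] at h1
    nlinarith [sq_nonneg (|y i - a i| - 1)]
  calc _ ≤ (b * ‖y - a‖ ^ 2 + b) * gauss b a y := by gcongr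
    _ = ‖y - a‖ ^ 2 * gauss b a y * b + b * gauss b a y := by ring
    _ ≤ 1 + b * 1 := by
      gcongr
      exact gauss_le_one hb.le a y
    _ = 1 + b := by ring

lemma integral_gauss {b : ℝ} (hb : 0 < b) (a : Space d) :
    ∫ y, gauss b a y = (Real.pi / b) ^ ((d : ℝ) / 2) := by
  have h := GaussianFourier.integral_rexp_neg_mul_sq_norm (V := Space d) hb
  rw [← integral_sub_right_eq_self _ a] at h
  simpa [gauss] using h

lemma integrable_gauss {b : ℝ} (hb : 0 < b) (a : Space d) : Integrable (gauss b a) := by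
  refine .of_integral_ne_zero ?_
  rw [integral_gauss hb]
  have := Real.pi_pos
  positivity

/-- Half of the exponent absorbs the polynomial factor; integrability and square integrability then
follow from those of a Gaussian. -/
lemma abs_gaussLap_le {b : ℝ} (hb : 0 < b) (a y : Space d) :
    |gaussLap b a y| ≤ (8 * b + 2 * b * d) * gauss (b / 2) a y := by
  have h1 := sq_mul_gauss_le (half_pos hb) a y
  have h2 : gauss b a y = gauss (b / 2) a y * gauss (b / 2) a y := by
    rw [gauss, gauss, ← Real.exp_add]
    congr 1
    ring
  have h3 := gauss_pos (b / 2) a y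
  have h4 := gauss_le_one (half_pos hb).le a y
  rw [gaussLap, abs_mul, abs_of_pos (gauss_pos b a y), h2, ← mul_assoc]
  gcongr
  have h5 : |4 * b ^ 2 * ‖y - a‖ ^ 2 - 2 * b * d| ≤ 4 * b ^ 2 * ‖y - a‖ ^ 2 + 2 * b * d := by
    refine (abs_sub _ _).trans ?_
    rw [abs_of_nonneg (by positivity), abs_of_nonneg (by positivity)]
  calc _ ≤ (4 * b ^ 2 * ‖y - a‖ ^ 2 + 2 * b * d) * gauss (b / 2) a y := by gcongr
    _ = 4 * b ^ 2 * (‖y - a‖ ^ 2 * gauss (b / 2) a y) + 2 * b * d * gauss (b / 2) a y := by ring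
    _ ≤ 4 * b ^ 2 * (1 / (b / 2)) + 2 * b * d * 1 := by gcongr
    _ = 8 * b + 2 * b * d := by field_simp; ring

lemma continuous_gaussLap (b : ℝ) (a : Space d) : Continuous (gaussLap b a) := by
  unfold gaussLap gauss
  fun_prop

lemma integrable_gaussLap {b : ℝ} (hb : 0 < b) (a : Space d) : Integrable (gaussLap b a) :=
  ((integrable_gauss (half_pos hb) a).const_mul (8 * b + 2 * b * d)).mono'
    (continuous_gaussLap b a).aestronglyMeasurable (.of_forall (abs_gaussLap_le hb a))

lemma memLp_gauss {b : ℝ} (hb : 0 < b) (a : Space d) : MemLp (gauss b a) 2 volume := by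
  rw [memLp_two_iff_integrable_sq (continuous_gauss b a).aestronglyMeasurable]
  refine (integrable_gauss (b := 2 * b) (by positivity) a).congr (.of_forall fun y => ?_)
  simp only [gauss]
  rw [← Real.exp_nat_mul]
  congr 1
  push_cast
  ring

lemma memLp_gaussLap {b : ℝ} (hb : 0 < b) (a : Space d) : MemLp (gaussLap b a) 2 volume :=
  ((memLp_gauss (half_pos hb) a).const_mul (8 * b + 2 * b * d)).mono'
    (continuous_gaussLap b a).aestronglyMeasurable (.of_forall (abs_gaussLap_le hb a))

lemma integrable_bdd_mul_norm {f : Space d → ℂ} (hf : Integrable f) {g : Space d → ℝ}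
    (hg : Continuous g) {C : ℝ} (hC : ∀ x, |g x| ≤ C) : Integrable fun x => g x * ‖f x‖ :=
  hf.norm.bdd_mul (c := C) hg.aestronglyMeasurable (.of_forall hC)

lemma hasDerivAt_integral_gauss {f : Space d → ℂ} (hf : Integrable f) (a : Space d) {b : ℝ}
    (hb : 0 < b) :
    HasDerivAt (fun b => ∫ y, gauss b a y * ‖f y‖)
      (∫ y, -‖y - a‖ ^ 2 * gauss b a y * ‖f y‖) b := by
  refine (hasDerivAt_integral_of_dominated_loc_of_deriv_le (s := Ioi (b / 2))
    (F' := fun b y => -‖y - a‖ ^ 2 * gauss b a y * ‖f y‖)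
    (bound := fun y => 1 / (b / 2) * ‖f y‖) (Ioi_mem_nhds (half_lt_self hb)) ?_ ?_ ?_ ?_ ?_ ?_).2
  · exact .of_forall fun b => (continuous_gauss b a).aestronglyMeasurable.mul
      hf.norm.aestronglyMeasurable
  · exact integrable_bdd_mul_norm hf (continuous_gauss b a) (C := 1) fun y => by
      rw [abs_of_pos (gauss_pos b a y)]
      exact gauss_le_one hb.le a y
  · refine Continuous.aestronglyMeasurable ?_ |>.mul hf.norm.aestronglyMeasurable
    have := continuous_gauss b a
    fun_prop
  · refine .of_forall fun y c hc => ?_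
    have hc : b / 2 < c := hc
    have hc0 : 0 < c := (half_pos hb).trans hc
    have h1 := sq_mul_gauss_le hc0 a y
    rw [norm_mul, norm_norm, neg_mul, norm_neg, Real.norm_eq_abs,
      abs_of_nonneg (mul_nonneg (sq_nonneg _) (gauss_pos c a y).le)]
    gcongr
    refine h1.trans ?_
    gcongr
  · exact hf.norm.const_mul _
  · refine .of_forall fun y c _ => ?_
    have h1 : HasDerivAt (fun c : ℝ => gauss c a y) _ c :=
      (((hasDerivAt_id c).neg.mul_const (‖y - a‖ ^ 2))).exp
    refine (h1.mul_const ‖f y‖).congr_deriv ?_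
    simp only [gauss, Pi.neg_apply, id]
    ring

/-- Monotonicity of the heat flow applied to a subsolution. -/
lemma antitoneOn_gauss_mean {f : Space d → ℂ} (hf : Integrable f) (a : Space d) {l : ℝ}
    (hk : ∀ b, 0 < b → -∫ y, gaussLap b a y * ‖f y‖ ≤ l * ∫ y, gauss b a y * ‖f y‖) :
    AntitoneOn (fun b => b ^ ((d : ℝ) / 2) * Real.exp (l / 4 * b⁻¹) * ∫ y, gauss b a y * ‖f y‖)
      (Ioi 0) := by
  -- With $b=1/(4t)$ the function in question is $\pi^{d/2}\mathrm e^{lt}(\mathrm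
  -- e^{t\Delta}|f|)(a)$. Writing the integral against `gaussLap` through `m` and `m'` turns `hk`
  -- into the sign of its derivative.
  set m : ℝ → ℝ := fun b => ∫ y, gauss b a y * ‖f y‖ with hm
  set m' : ℝ → ℝ := fun b => ∫ y, -‖y - a‖ ^ 2 * gauss b a y * ‖f y‖ with hm'
  have hderiv : ∀ b, 0 < b → HasDerivAt
      (fun b => b ^ ((d : ℝ) / 2) * Real.exp (l / 4 * b⁻¹) * m b)
      (b ^ ((d : ℝ) / 2) * Real.exp (l / 4 * b⁻¹) / (4 * b ^ 2) *
        (2 * b * d * m b - l * m b + 4 * b ^ 2 * m' b)) b := fun b hb => by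
    have h1 := Real.hasDerivAt_rpow_const (x := b) (p := (d : ℝ) / 2) (Or.inl hb.ne')
    have h2 := (((hasDerivAt_inv hb.ne').const_mul (l / 4))).exp
    refine ((h1.fun_mul h2).fun_mul (hasDerivAt_integral_gauss hf a hb)).congr_deriv ?_
    rw [Real.rpow_sub_one hb.ne']
    simp only [hm, hm']
    field_simp
    ring
  have hineq : ∀ b, 0 < b → 2 * b * d * m b - l * m b + 4 * b ^ 2 * m' b ≤ 0 := fun b hb => by
    have h1 := hk b hb
    have h2 : ∫ y, gaussLap b a y * ‖f y‖ = -(4 * b ^ 2) * m' b - 2 * b * d * m b := by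
      have i1 : Integrable fun y => gauss b a y * ‖f y‖ :=
        integrable_bdd_mul_norm hf (continuous_gauss b a) (C := 1) fun y => by
          rw [abs_of_pos (gauss_pos b a y)]
          exact gauss_le_one hb.le a y
      have i2 : Integrable fun y => -‖y - a‖ ^ 2 * gauss b a y * ‖f y‖ :=
        integrable_bdd_mul_norm hf (by have := continuous_gauss b a; fun_prop) (C := 1 / b)
          fun y => by
            rw [neg_mul, abs_neg, abs_of_nonneg (mul_nonneg (sq_nonneg _) (gauss_pos b a y).le)]
            exact sq_mul_gauss_le hb a y
      simp only [hm, hm']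
      rw [← integral_const_mul, ← integral_const_mul,
        ← integral_sub (i2.const_mul _) (i1.const_mul _)]
      congr 1 with y
      simp only [gaussLap]
      ring
    rw [h2] at h1
    linarith
  refine antitoneOn_of_deriv_nonpos (convex_Ioi 0)
    (fun b hb => (hderiv b hb).continuousAt.continuousWithinAt)
    (fun b hb => (hderiv b (interior_subset hb)).differentiableAt.differentiableWithinAt)
    fun b hb => ?_
  have hb0 : 0 < b := interior_subset hb
  rw [(hderiv b hb0).deriv]
  exact mul_nonpos_of_nonneg_of_nonpos (by positivity) (hineq b hb0)

/-- Cauchy–Schwarz; squaring a Gaussian doubles its parameter. -/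
lemma integral_gauss_mul_norm_le {b : ℝ} (hb : 0 < b) (a : Space d) (f : L2 d) :
    ∫ y, gauss b a y * ‖f y‖ ≤ √((Real.pi / (2 * b)) ^ ((d : ℝ) / 2)) * ‖f‖ := by
  have hG := (memLp_gauss hb a).ofReal (K := ℂ)
  set G : L2 d := hG.toLp with hGdef
  have h1 : ∀ᵐ y, ‖G y‖ = gauss b a y := by
    filter_upwards [hG.coeFn_toLp] with y hy
    rw [hGdef, hy]
    simp [abs_of_pos (gauss_pos b a y)]
  have h2 := (integral_norm_mul_norm_le G f).2
  have h3 : ‖G‖ = √((Real.pi / (2 * b)) ^ ((d : ℝ) / 2)) := by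
    rw [← integral_gauss (by positivity) a]
    refine (Real.sqrt_eq_iff_mul_self_eq (integral_nonneg fun y => (gauss_pos _ a y).le)
      (norm_nonneg _)).2 ?_ |>.symm
    rw [← pow_two, L2_norm_sq]
    refine integral_congr_ae ?_
    filter_upwards [h1] with y hy
    rw [hy]
    simp only [gauss]
    rw [← Real.exp_nat_mul]
    congr 1
    push_cast
    ring
  rw [← h3]
  refine le_of_eq_of_le (integral_congr_ae ?_) h2
  filter_upwards [h1] with y hy
  rw [hy]

/-! ### From Gaussian means to almost-everywhere bounds -/

/-- The normalized Gaussian. -/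
def stdGauss (x : Space d) : ℝ := Real.pi ^ (-((d : ℝ) / 2)) * Real.exp (-‖x‖ ^ 2)

lemma integral_stdGauss : ∫ x : Space d, stdGauss x = 1 := by
  have h := GaussianFourier.integral_rexp_neg_mul_sq_norm (V := Space d) one_pos
  simp only [neg_mul, one_mul, div_one, finrank_euclideanSpace_fin] at h
  simp only [stdGauss]
  rw [integral_const_mul, h, ← Real.rpow_add Real.pi_pos]
  simp

lemma tendsto_stdGauss : Tendsto (fun x : Space d => ‖x‖ ^ d * stdGauss x)
    (Bornology.cobounded (Space d)) (𝓝 0) := by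
  have h1 : Tendsto (fun t : ℝ => Real.pi ^ (-((d : ℝ) / 2)) * (t ^ d * Real.exp (-t ^ 2)))
      atTop (𝓝 (Real.pi ^ (-((d : ℝ) / 2)) * 0)) := by
    refine Tendsto.const_mul _ ?_
    refine squeeze_zero' (g := fun t : ℝ => t ^ d * Real.exp (-t))
      (eventually_ge_atTop 0 |>.mono fun t ht => by positivity) ?_
      (Real.tendsto_pow_mul_exp_neg_atTop_nhds_zero d)
    filter_upwards [eventually_ge_atTop 1] with t ht
    gcongr
    nlinarith
  rw [mul_zero] at h1
  refine (h1.comp tendsto_norm_cobounded_atTop).congr fun x => ?_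
  simp only [Function.comp_apply, stdGauss]
  ring

/-- Dictionary between the approximate identity of scale $1/c$ and the Gaussian with parameter
$b=c^2$. -/
lemma pow_mul_stdGauss {c : ℝ} (hc : 0 < c) (a y : Space d) :
    c ^ d * stdGauss (c • (y - a)) =
      Real.pi ^ (-((d : ℝ) / 2)) * (c ^ 2) ^ ((d : ℝ) / 2) * gauss (c ^ 2) a y := by
  have h1 : (c ^ 2) ^ ((d : ℝ) / 2) = c ^ d := by
    rw [← Real.rpow_natCast c 2, ← Real.rpow_mul hc.le, ← Real.rpow_natCast c d]
    congr 1
    push_cast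
    ring
  rw [h1, stdGauss, gauss, norm_smul, Real.norm_eq_abs, abs_of_pos hc, mul_pow]
  ring_nf

lemma stdGauss_nonneg (x : Space d) : 0 ≤ stdGauss x := by
  unfold stdGauss
  positivity

lemma continuous_stdGauss : Continuous (stdGauss : Space d → ℝ) := by
  unfold stdGauss
  fun_prop

lemma integral_pow_mul_stdGauss {c : ℝ} (hc : 0 < c) (y : Space d) :
    ∫ a, c ^ d * stdGauss (c • (y - a)) = 1 := by
  rw [integral_const_mul, integral_sub_left_eq_self (fun x => stdGauss (c • x)) volume y,
    Measure.integral_comp_smul, integral_stdGauss, finrank_euclideanSpace_fin, smul_eq_mul, mul_one,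
    abs_of_pos (by positivity), mul_inv_cancel₀ (by positivity)]

/-- If all Gaussian means of an integrable function are at most `Q`, so is its integral against a
continuous nonnegative function of compact support and integral one. -/
lemma integral_mul_le_of_gauss_mean_le {f : Space d → ℝ} (hf : Integrable f) (hf0 : ∀ x, 0 ≤ f x)
    {c₀ Q : ℝ} (hQ : ∀ a : Space d, ∀ c, c₀ ≤ c → ∫ y, c ^ d * stdGauss (c • (y - a)) * f y ≤ Q)
    {h : Space d → ℝ} (hc : Continuous h) (hcs : HasCompactSupport h) (h0 : ∀ x, 0 ≤ h x)
    (h1 : ∫ x, h x = 1) : ∫ x, h x * f x ≤ Q := by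
  have hhi : Integrable h := hc.integrable_of_hasCompactSupport hcs
  obtain ⟨C, hC⟩ := hc.bounded_above_of_compact_support hcs
  have hkernel : ∀ c : ℝ, Continuous fun z : Space d × Space d =>
      c ^ d * stdGauss (c • (z.2 - z.1)) := fun c => by
    have := continuous_stdGauss (d := d)
    fun_prop
  -- By Fubini the averaging moves from `f`, which is merely integrable, to the continuous `h`.
  -- Hence `T c → h` at every point, bounded by `C`.
  set T : ℝ → Space d → ℝ := fun c y => ∫ a, c ^ d * stdGauss (c • (y - a)) * h a with hT
  have hTb : ∀ c, 0 < c → ∀ y, |T c y| ≤ C := fun c hc0 y => by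
    have e1 : C = ∫ a, c ^ d * stdGauss (c • (y - a)) * C := by
      rw [integral_mul_const, integral_pow_mul_stdGauss hc0, one_mul]
    rw [e1]
    change ‖∫ a, c ^ d * stdGauss (c • (y - a)) * h a‖ ≤ _
    refine (norm_integral_le_integral_norm _).trans (integral_mono_of_nonneg
      (.of_forall fun a => by exact norm_nonneg _) ?_ (.of_forall fun a => ?_))
    · refine Integrable.mul_const ?_ C
      refine .of_integral_ne_zero ?_
      rw [integral_pow_mul_stdGauss hc0]
      exact one_ne_zero
    · have := stdGauss_nonneg (c • (y - a))
      simp only [norm_mul, norm_pow, Real.norm_eq_abs, abs_of_pos hc0, abs_of_nonneg this]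
      gcongr
      exact hC a
  have hprod : ∀ c, 0 < c → Integrable (fun z : Space d × Space d =>
      c ^ d * stdGauss (c • (z.2 - z.1)) * (h z.1 * f z.2)) (volume.prod volume) := fun c hc0 => by
    refine (hhi.mul_prod hf).bdd_mul (c := c ^ d * Real.pi ^ (-((d : ℝ) / 2)))
      (hkernel c).aestronglyMeasurable (.of_forall fun z => ?_)
    rw [norm_mul, norm_pow, Real.norm_eq_abs, abs_of_pos hc0, Real.norm_eq_abs,
      abs_of_nonneg (stdGauss_nonneg _), stdGauss]
    gcongr
    refine mul_le_of_le_one_right (by positivity) (Real.exp_le_one_iff.2 ?_)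
    linarith [sq_nonneg ‖c • (z.2 - z.1)‖]
  have hswap : ∀ c, 0 < c → ∫ y, T c y * f y =
      ∫ a, h a * ∫ y, c ^ d * stdGauss (c • (y - a)) * f y := fun c hc0 => by
    have e1 := integral_integral_swap
      (f := fun a y => c ^ d * stdGauss (c • (y - a)) * (h a * f y)) (hprod c hc0)
    refine Eq.trans ?_ (e1.symm.trans ?_)
    · congr 1 with y
      simp only [hT]
      rw [← integral_mul_const]
      congr 1 with a
      ring
    · congr 1 with a
      rw [← integral_const_mul]
      congr 1 with y
      ring
  have hle : ∀ c, c₀ ≤ c → 0 < c → ∫ y, T c y * f y ≤ Q := fun c h1c hc0 => by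
    rw [hswap c hc0]
    have e1 : Q = ∫ a, h a * Q := by rw [integral_mul_const, h1, one_mul]
    rw [e1]
    refine integral_mono_of_nonneg (.of_forall fun a => mul_nonneg (h0 a) (integral_nonneg
      fun y => ?_)) (hhi.mul_const Q) (.of_forall fun a => ?_)
    · have := stdGauss_nonneg (c • (y - a))
      have := hf0 y
      simp only [Pi.zero_apply]
      positivity
    · exact mul_le_mul_of_nonneg_left (hQ a c h1c) (h0 a)
  have hlim : Tendsto (fun c => ∫ y, T c y * f y) atTop (𝓝 (∫ y, h y * f y)) := by
    refine tendsto_integral_filter_of_dominated_convergence (fun y => C * f y) ?_ ?_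
      (hf.const_mul C) (.of_forall fun y => ?_)
    · filter_upwards [eventually_gt_atTop 0] with c hc0
      refine AEStronglyMeasurable.mul ?_ hf.aestronglyMeasurable
      refine StronglyMeasurable.aestronglyMeasurable ?_
      refine StronglyMeasurable.integral_prod_right
        (f := fun y a => c ^ d * stdGauss (c • (y - a)) * h a) ?_
      refine Continuous.stronglyMeasurable ?_
      have := continuous_stdGauss (d := d)
      simp only [Function.uncurry_def]
      fun_prop
    · filter_upwards [eventually_gt_atTop 0] with c hc0
      refine .of_forall fun y => ?_
      rw [norm_mul, Real.norm_eq_abs, Real.norm_eq_abs, abs_of_nonneg (hf0 y)]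
      exact mul_le_mul_of_nonneg_right (hTb c hc0 y) (hf0 y)
    · refine Tendsto.mul_const _ ?_
      have e1 := tendsto_integral_comp_smul_smul_of_integrable' (μ := (volume : Measure (Space d)))
        stdGauss_nonneg integral_stdGauss (by simpa using tendsto_stdGauss (d := d)) hhi
        (hc.continuousAt (x := y))
      simpa [hT] using e1
  refine le_of_tendsto hlim ?_
  filter_upwards [eventually_gt_atTop 0, eventually_ge_atTop c₀] with c hc0 h1c
  exact hle c h1c hc0

/-- Mollifiers serve as the functions `h` of the previous bound; the mollified `f` converges to `f`
almost everywhere. The outer radius of the bumps is twice the inner one, as `K = 2` requires. -/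
lemma ae_le_of_gauss_mean_le {f : Space d → ℝ} (hf : Integrable f) (hf0 : ∀ x, 0 ≤ f x)
    {c₀ Q : ℝ} (hQ : ∀ a : Space d, ∀ c, c₀ ≤ c → ∫ y, c ^ d * stdGauss (c • (y - a)) * f y ≤ Q) :
    ∀ᵐ x, f x ≤ Q := by
  set φ : ℕ → ContDiffBump (0 : Space d) := fun n =>
    ⟨1 / ((n : ℝ) + 1), 2 * (1 / ((n : ℝ) + 1)), by positivity, by
      have : 0 < 1 / ((n : ℝ) + 1) := by positivity
      linarith⟩ with hφ
  have h1 := ContDiffBump.ae_convolution_tendsto_right_of_locallyIntegrable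
    (μ := (volume : Measure (Space d))) (φ := φ) (l := atTop) (K := 2)
    (by simpa [hφ] using (tendsto_one_div_add_atTop_nhds_zero_nat (𝕜 := ℝ)).const_mul 2)
    (.of_forall fun n => le_rfl) hf.locallyIntegrable
  filter_upwards [h1] with x hx
  refine le_of_tendsto' hx fun n => ?_
  rw [convolution_eq_swap]
  simp only [ContinuousLinearMap.lsmul_apply, smul_eq_mul]
  refine integral_mul_le_of_gauss_mean_le hf hf0 hQ (h := fun y => (φ n).normed volume (x - y))
    ?_ ?_ (fun y => (φ n).nonneg_normed _) ?_
  · exact (φ n).continuous_normed.comp (continuous_const.sub continuous_id)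
  · exact (φ n).hasCompactSupport_normed.comp_homeomorph (Homeomorph.subLeft x)
  · rw [integral_sub_left_eq_self (fun y => (φ n).normed volume y) volume x]
    exact (φ n).integral_normed

/-- `L²` limits of functions supported in a fixed ball vanish off it, and on a set of finite measure
`L²` lies in `L¹`. -/
lemma integrable_fst_of_mem_H10 {U : Set (Space d)} (hU : Bornology.IsBounded U) {ψ : Jet d}
    (hψ : ψ ∈ H10 U) : Integrable ψ.fst := by
  obtain ⟨R, hR⟩ := hU.subset_closedBall 0
  set K := Metric.closedBall (0 : Space d) R with hK
  have hKm : MeasurableSet K := Metric.isClosed_closedBall.measurableSet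
  have hsq : ∀ F : L2 d, Integrable fun x => ‖F x‖ ^ 2 := fun F =>
    (Lp.memLp F).integrable_norm_pow (by norm_num)
  have hle : ∀ w ∈ testJets U, ∫ x in Kᶜ, ‖ψ.fst x‖ ^ 2 ≤ ‖ψ - w‖ ^ 2 := fun w hw => by
    obtain ⟨f, hf, hwf, -⟩ := hw
    have e1 : ∫ x in Kᶜ, ‖ψ.fst x‖ ^ 2 = ∫ x in Kᶜ, ‖(ψ - w).fst x‖ ^ 2 := by
      refine setIntegral_congr_ae hKm.compl ?_
      filter_upwards [hwf, Lp.coeFn_sub ψ.fst w.fst] with x h1 h2 hx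
      have : f x = 0 := image_eq_zero_of_notMem_tsupport fun h => hx (hR (hf.2.2 h))
      rw [WithLp.sub_fst, h2, Pi.sub_apply, h1, this, sub_zero]
    rw [e1]
    refine (setIntegral_le_integral (hsq _) (.of_forall fun x => sq_nonneg _)).trans ?_
    rw [← L2_norm_sq]
    gcongr
    exact norm_fst_le _
  have h0 : ∫ x in Kᶜ, ‖ψ.fst x‖ ^ 2 = 0 := by
    obtain ⟨w, hw, hlim⟩ := mem_closure_iff_seq_limit.1
      (show ψ ∈ closure (testJets U : Set (Jet d)) from hψ)
    have h1 : Tendsto (fun n => ‖ψ - w n‖ ^ 2) atTop (𝓝 (‖ψ - ψ‖ ^ 2)) :=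
      ((tendsto_const_nhds.sub hlim).norm).pow 2
    rw [sub_self, norm_zero, zero_pow two_ne_zero] at h1
    exact le_antisymm (ge_of_tendsto' h1 fun n => hle _ (hw n))
      (integral_nonneg fun x => sq_nonneg _)
  have h1 : ∀ᵐ x ∂volume.restrict Kᶜ, ψ.fst x = 0 := by
    have := (setIntegral_eq_zero_iff_of_nonneg_ae (.of_forall fun x => sq_nonneg _)
      (hsq ψ.fst).integrableOn).1 h0
    filter_upwards [this] with x hx
    simpa using hx
  have h2 : IntegrableOn ψ.fst K := by
    have : IsFiniteMeasure (volume.restrict K) :=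
      ⟨by simpa using (isCompact_closedBall (0 : Space d) R).measure_lt_top⟩
    exact ((Lp.memLp ψ.fst).restrict K).integrable (by norm_num)
  have h3 : IntegrableOn ψ.fst Kᶜ :=
    (integrable_zero (Space d) ℂ _).congr (h1.mono fun x hx => by simp [hx])
  rw [← integrableOn_univ, ← union_compl_self K]
  exact h2.union h3

/-- The heat kernel bound for normalized eigenfunctions of the Dirichlet Laplacian. -/
theorem ae_norm_sq_le_of_isEigenfunction {U : Set (Space d)} (hU : Bornology.IsBounded U) {l L : ℝ}
    (hl : 0 ≤ l) (hlL : l ≤ L) (hL : 0 < L) {φ : Jet d} (hφ : IsEigenfunction U (fun _ => 0) l φ)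
    (hn : ‖φ.fst‖ = 1) :
    ∀ᵐ x, ‖φ.fst x‖ ^ 2 ≤ (L / (4 * Real.pi)) ^ ((d : ℝ) / 2) * Real.exp 1 := by
  have hπ := Real.pi_pos
  have hφ1 := integrable_fst_of_mem_H10 hU hφ.1
  have hk : ∀ a : Space d, ∀ b, 0 < b → -∫ y, gaussLap b a y * ‖φ.fst y‖ ≤
      L * ∫ y, gauss b a y * ‖φ.fst y‖ := fun a b hb => by
    refine (kato_inequality hl hφ hφ1 (B := 1 + b) (contDiff_gauss b a)
      (fun x => (gauss_pos b a x).le) (fun x => (gauss_le_one hb.le a x).trans (by linarith))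
      (fun i x => abs_fderiv_gauss_le hb a x i) (gaussLap_eq_sum b a) (integrable_gaussLap hb a)
      (memLp_gaussLap hb a)).trans ?_
    gcongr
    exact integral_nonneg fun y => mul_nonneg (gauss_pos b a y).le (norm_nonneg _)
  -- Heat time $t=1/(4b_0)=1/(2L)$, so $\mathrm e^{2Lt}=\mathrm e$ and the squared Cauchy–Schwarz
  -- factor is $(8\pi t)^{-d/2}=(L/4\pi)^{d/2}$. Working with a positive `L ≥ l` avoids dividing by
  -- `l`.
  set b₀ := L / 2 with hb₀
  have hb₀0 : 0 < b₀ := half_pos hL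
  set Q := Real.pi ^ (-((d : ℝ) / 2)) * (b₀ ^ ((d : ℝ) / 2) * Real.exp (L / 4 * b₀⁻¹) *
    √((Real.pi / (2 * b₀)) ^ ((d : ℝ) / 2))) with hQ
  have hmean : ∀ a : Space d, ∀ c, √b₀ ≤ c →
      ∫ y, c ^ d * stdGauss (c • (y - a)) * ‖φ.fst y‖ ≤ Q := fun a c hc => by
    have hc0 : 0 < c := (Real.sqrt_pos.2 hb₀0).trans_le hc
    have hbc : b₀ ≤ c ^ 2 := (Real.sqrt_le_left hc0.le).1 hc
    have h1 := antitoneOn_gauss_mean hφ1 a (hk a) (mem_Ioi.2 hb₀0)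
      (mem_Ioi.2 (pow_pos hc0 2)) hbc
    simp only at h1
    have h2 := integral_gauss_mul_norm_le hb₀0 a φ.fst
    rw [hn, mul_one] at h2
    simp only [pow_mul_stdGauss hc0, mul_assoc]
    rw [integral_const_mul, integral_const_mul, hQ]
    refine mul_le_mul_of_nonneg_left ?_ (by positivity)
    have h0 : 0 ≤ ∫ y, gauss (c ^ 2) a y * ‖φ.fst y‖ :=
      integral_nonneg fun y => mul_nonneg (gauss_pos _ a y).le (norm_nonneg _)
    have h3 : 1 ≤ Real.exp (L / 4 * (c ^ 2)⁻¹) := Real.one_le_exp (by positivity)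
    calc (c ^ 2) ^ ((d : ℝ) / 2) * ∫ y, gauss (c ^ 2) a y * ‖φ.fst y‖
        ≤ (c ^ 2) ^ ((d : ℝ) / 2) * Real.exp (L / 4 * (c ^ 2)⁻¹) *
          ∫ y, gauss (c ^ 2) a y * ‖φ.fst y‖ := by
          gcongr
          exact le_mul_of_one_le_right (by positivity) h3
      _ ≤ _ := h1
      _ ≤ _ := by gcongr
  have hQ2 : Q ^ 2 = (L / (4 * Real.pi)) ^ ((d : ℝ) / 2) * Real.exp 1 := by
    have e1 : Real.exp (L / 4 * b₀⁻¹) ^ 2 = Real.exp 1 := by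
      rw [← Real.exp_nat_mul]
      congr 1
      rw [hb₀]
      push_cast
      field_simp
      norm_num
    have e2 : (Real.pi ^ (-((d : ℝ) / 2))) ^ 2 * (b₀ ^ ((d : ℝ) / 2)) ^ 2 *
        (Real.pi / (2 * b₀)) ^ ((d : ℝ) / 2) = (L / (4 * Real.pi)) ^ ((d : ℝ) / 2) := by
      rw [Real.rpow_neg hπ.le, ← Real.inv_rpow hπ.le, ← mul_pow,
        ← Real.mul_rpow (by positivity) hb₀0.le, sq, ← Real.mul_rpow (by positivity) (by positivity),
        ← Real.mul_rpow (by positivity) (by positivity)]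
      congr 1
      rw [hb₀]
      field_simp
      norm_num
    rw [hQ, ← e2, ← e1, mul_pow, mul_pow, mul_pow, Real.sq_sqrt (by positivity)]
    ring
  filter_upwards [ae_le_of_gauss_mean_le hφ1.norm (fun x => norm_nonneg _) hmean] with x hx
  rw [← hQ2]
  gcongr

end HeatKernel

/-! ### Schrödinger operators with bounded potentials -/

section Schrodinger

open Filter Topology

variable {d : ℕ}

/-- Multiplication by a bounded real function on `L²`. -/
def mulOp {W : Space d → ℝ} (hW : MemLp W ∞ volume) : L2 d →L[ℂ] L2 d :=
  (ContinuousLinearMap.mul ℂ ℂ).holderL volume ∞ 2 2 (hW.ofReal (K := ℂ)).toLp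

lemma coeFn_mulOp {W : Space d → ℝ} (hW : MemLp W ∞ volume) (f : L2 d) :
    mulOp hW f =ᵐ[volume] fun x => (W x : ℂ) * f x := by
  have h := (ContinuousLinearMap.mul ℂ ℂ).coeFn_holder (r := 2) (hW.ofReal (K := ℂ)).toLp f
  filter_upwards [h, (hW.ofReal (K := ℂ)).coeFn_toLp] with x h1 h2
  rw [mulOp, ContinuousLinearMap.holderL_apply_apply, h1, h2]
  rfl

lemma inner_mulOp {W : Space d → ℝ} (hW : MemLp W ∞ volume) (f g : L2 d) :
    inner ℂ f (mulOp hW g) = ∫ x, (W x : ℂ) * (conj (f x) * g x) := by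
  rw [L2_inner]
  refine integral_congr_ae ?_
  filter_upwards [coeFn_mulOp hW g] with x hx
  rw [hx]
  ring

lemma mulOp_inner {W : Space d → ℝ} (hW : MemLp W ∞ volume) (f g : L2 d) :
    inner ℂ (mulOp hW f) g = inner ℂ f (mulOp hW g) := by
  rw [inner_mulOp, L2_inner]
  refine integral_congr_ae ?_
  filter_upwards [coeFn_mulOp hW f] with x hx
  rw [hx, map_mul, Complex.conj_ofReal]
  ring

/-- The operator on the form domain that represents the form of `-Δ + W`. -/
def formOp {W : Space d → ℝ} (hW : MemLp W ∞ volume) : Jet d →L[ℂ] Jet d :=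
  ContinuousLinearMap.id ℂ (Jet d) +
    (ContinuousLinearMap.adjoint (fstCLM d)).comp
      ((mulOp hW - ContinuousLinearMap.id ℂ (L2 d)).comp (fstCLM d))

lemma Jet_inner (χ ψ : Jet d) :
    inner ℂ χ ψ = inner ℂ χ.fst ψ.fst + inner ℂ χ.snd ψ.snd := WithLp.prod_inner_apply χ ψ

/-- The identity contributes the full `H¹` inner product; the `-1` next to `mulOp hW` removes its
`L²` part. -/
lemma inner_formOp_eq {W : Space d → ℝ} (hW : MemLp W ∞ volume) (χ ψ : Jet d) :
    inner ℂ χ (formOp hW ψ) = inner ℂ χ.snd ψ.snd + inner ℂ χ.fst (mulOp hW ψ.fst) := by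
  simp only [formOp, _root_.add_apply, ContinuousLinearMap.id_apply,
    ContinuousLinearMap.comp_apply, _root_.sub_apply, inner_add_right,
    ContinuousLinearMap.adjoint_inner_right, inner_sub_right, fstCLM_apply, Jet_inner]
  ring

lemma inner_formOp {W : Space d → ℝ} (hW : MemLp W ∞ volume) (χ ψ : Jet d) :
    inner ℂ χ (formOp hW ψ) = schrodingerForm W χ ψ := by
  rw [inner_formOp_eq, schrodingerForm, inner_mulOp, PiLp.inner_apply]
  simp only [L2_inner]

lemma isSymmetric_formOp {W : Space d → ℝ} (hW : MemLp W ∞ volume) :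
    (formOp hW).IsSymmetric := fun χ ψ => by
  simp only [ContinuousLinearMap.coe_coe]
  rw [← inner_conj_symm, inner_formOp_eq, inner_formOp_eq, map_add, inner_conj_symm,
    inner_conj_symm, mulOp_inner]

lemma integrable_mul_norm_sq {W : Space d → ℝ} (hW : MemLp W ∞ volume) (f : L2 d) :
    Integrable fun x => W x * ‖f x‖ ^ 2 :=
  ((Lp.memLp f).integrable_norm_pow (by norm_num)).mul_of_top_right hW

lemma quad_formOp {W : Space d → ℝ} (hW : MemLp W ∞ volume) (ψ : Jet d) :
    quad (formOp hW) ψ = ‖ψ.snd‖ ^ 2 + ∫ x, W x * ‖ψ.fst x‖ ^ 2 := by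
  have h1 : inner ℂ ψ.fst (mulOp hW ψ.fst) = ((∫ x, W x * ‖ψ.fst x‖ ^ 2 : ℝ) : ℂ) := by
    rw [inner_mulOp, ← integral_complex_ofReal]
    congr 1 with x
    rw [Complex.conj_mul']
    push_cast
    rfl
  rw [quad, inner_formOp_eq, h1, Complex.add_re, Complex.ofReal_re, inner_self_eq_norm_sq_to_K]
  norm_cast

lemma coerciveOn_formOp {W : Space d → ℝ} (hW : MemLp W ∞ volume) (V : Submodule ℂ (Jet d)) :
    CoerciveOn V (fstCLM d) (formOp hW) := by
  refine ⟨1 + ‖mulOp hW‖, fun ψ _ => ?_⟩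
  have h1 : -(‖mulOp hW‖ * ‖ψ.fst‖ ^ 2) ≤ (inner ℂ ψ.fst (mulOp hW ψ.fst)).re := by
    have h2 := (Complex.abs_re_le_norm _).trans (norm_inner_le_norm (𝕜 := ℂ) ψ.fst (mulOp hW ψ.fst))
    have h3 := (mulOp hW).le_opNorm ψ.fst
    have h4 : ‖ψ.fst‖ * ‖mulOp hW ψ.fst‖ ≤ ‖mulOp hW‖ * ‖ψ.fst‖ ^ 2 := by
      calc _ ≤ ‖ψ.fst‖ * (‖mulOp hW‖ * ‖ψ.fst‖) := by gcongr
        _ = _ := by ring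
    exact (abs_le.1 (h2.trans h4)).1
  have h2 : quad (formOp hW) ψ = ‖ψ.snd‖ ^ 2 + (inner ℂ ψ.fst (mulOp hW ψ.fst)).re := by
    rw [quad, inner_formOp_eq, Complex.add_re, inner_self_eq_norm_sq_to_K]
    norm_cast
  rw [h2, WithLp.prod_norm_sq_eq_of_L2, fstCLM_apply]
  linarith

lemma isEigenfunction_iff {W : Space d → ℝ} (hW : MemLp W ∞ volume) (U : Set (Space d)) (μ : ℝ)
    (ψ : Jet d) :
    IsEigenfunction U W μ ψ ↔ IsFormEigenvector (H10 U) (fstCLM d) (formOp hW) μ ψ := by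
  simp only [IsEigenfunction, IsFormEigenvector, inner_formOp, fstCLM_apply, L2_inner]

lemma eigenvalueBounds_eq {W : Space d → ℝ} (hW : MemLp W ∞ volume) (U : Set (Space d)) (k : ℕ) :
    eigenvalueBounds U W k = formEigenvalueBounds (H10 U) (fstCLM d) (formOp hW) k := by
  simp only [eigenvalueBounds, formEigenvalueBounds, isEigenfunction_iff hW]

lemma isTest_bump {U : Set (Space d)} {x : Space d} (f : ContDiffBump x)
    (hf : Metric.closedBall x f.rOut ⊆ U) : IsTest U fun y => (f y : ℂ) := by
  refine ⟨Complex.ofRealCLM.contDiff.comp f.contDiff, ?_, ?_⟩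
  · exact f.hasCompactSupport.comp_left (g := fun t : ℝ => (t : ℂ)) Complex.ofReal_zero
  · refine Subset.trans (closure_mono fun y hy => ?_) ((f.tsupport_eq).trans_subset hf)
    simpa using hy

/-- Two concentric bumps: at distance `R / 2` from the centre the narrow one vanishes and the wide
one equals one, while at the centre the narrow one equals one. -/
lemma exists_linearIndependent_H10 (hd : 0 < d) {U : Set (Space d)} (hU : IsOpen U)
    (hne : U.Nonempty) : ∃ f ∈ H10 U, ∃ g ∈ H10 U,
      LinearIndependent ℂ ![fstCLM d f, fstCLM d g] := by
  obtain ⟨x, hx⟩ := hne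
  obtain ⟨R, hR, hball⟩ := Metric.isOpen_iff.1 hU x hx
  have hsub : ∀ s < R, Metric.closedBall x s ⊆ U := fun s hs =>
    (Metric.closedBall_subset_ball hs).trans hball
  let b₁ : ContDiffBump x := ⟨R / 8, R / 4, by linarith, by linarith⟩
  let b₂ : ContDiffBump x := ⟨R / 2, 3 * R / 4, by linarith, by linarith⟩
  have ht₁ := isTest_bump b₁ (hsub (R / 4) (by linarith))
  have ht₂ := isTest_bump b₂ (hsub (3 * R / 4) (by linarith))
  obtain ⟨f, hf, hff, -⟩ := exists_testJet ht₁
  obtain ⟨g, hg, hgg, -⟩ := exists_testJet ht₂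
  refine ⟨f, Submodule.le_topologicalClosure _ hf, g, Submodule.le_topologicalClosure _ hg, ?_⟩
  rw [LinearIndependent.pair_iff]
  intro s t hst
  have h1 : (fun y => s * (b₁ y : ℂ) + t * (b₂ y : ℂ)) =ᵐ[volume] fun _ => 0 := by
    have e1 := Lp.coeFn_add (s • f.fst) (t • g.fst)
    have e2 : s • f.fst + t • g.fst = 0 := hst
    rw [e2] at e1
    filter_upwards [e1, Lp.coeFn_zero ℂ 2 (volume : Measure (Space d)), Lp.coeFn_smul s f.fst,
      Lp.coeFn_smul t g.fst, hff, hgg] with y h1 h2 h3 h4 h5 h6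
    rw [h2, Pi.add_apply, h3, h4, Pi.smul_apply, Pi.smul_apply, h5, h6] at h1
    exact h1.symm
  have h2 : (fun y => s * (b₁ y : ℂ) + t * (b₂ y : ℂ)) = fun _ => 0 :=
    Continuous.ae_eq_iff_eq (μ := (volume : Measure (Space d)))
    ((continuous_const.mul ht₁.1.continuous).add (continuous_const.mul ht₂.1.continuous))
    continuous_const |>.1 h1
  have hy : dist (x + (R / 2) • basisVec ⟨0, hd⟩ : Space d) x = R / 2 := by
    rw [dist_eq_norm, add_sub_cancel_left, norm_smul, PiLp.norm_single]
    simp [abs_of_pos hR]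
  have h3 := congrFun h2 (x + (R / 2) • basisVec ⟨0, hd⟩)
  have h4 := congrFun h2 x
  rw [b₁.zero_of_le_dist (by rw [hy]; change R / 4 ≤ R / 2; linarith),
    b₂.one_of_mem_closedBall (Metric.mem_closedBall.2 hy.le)] at h3
  have ht : t = 0 := by simpa using h3
  rw [b₁.one_of_mem_closedBall (Metric.mem_closedBall_self b₁.rIn_pos.le), ht] at h4
  exact ⟨by simpa using h4, ht⟩

theorem exists_isLowestPair_formOp (hd : 0 < d) {U : Set (Space d)} (hU : IsOpen U)
    (hb : Bornology.IsBounded U) (hne : U.Nonempty) {W : Space d → ℝ} (hW : MemLp W ∞ volume) :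
    HasEigenvalue U W 1 ∧ HasEigenvalue U W 2 ∧ ∃ ψ₁, IsLowestPair (H10 U) (fstCLM d) (formOp hW)
      (eigenvalue U W 1) (eigenvalue U W 2) ψ₁ := by
  obtain ⟨μ₁, μ₂, ψ₁, h⟩ := exists_isLowestPair (V := H10 U) (J := fstCLM d) (A := formOp hW)
    (Submodule.isClosed_topologicalClosure (testJets U)) (isSymmetric_formOp hW)
    (coerciveOn_formOp hW _) (compactOn_H10 hb) (exists_linearIndependent_H10 hd hU hne)
  have h1 := h.isLeast_one
  have h2 := h.isLeast_two
  rw [← eigenvalueBounds_eq] at h1 h2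
  have e1 : eigenvalue U W 1 = μ₁ := h1.csInf_eq
  have e2 : eigenvalue U W 2 = μ₂ := h2.csInf_eq
  rw [HasEigenvalue, HasEigenvalue, e1, e2]
  exact ⟨h1, h2, ψ₁, h⟩

/-- Comparison of the spectral gap of `-Δ + W - c`, `W ≥ 0`, with that of `-Δ`. -/
theorem gap_comparison (hd : 0 < d) {U : Set (Space d)} (hU : IsOpen U)
    (hb : Bornology.IsBounded U) (hne : U.Nonempty) {W : Space d → ℝ} {c : ℝ}
    (hW : MemLp (fun x => W x - c) ∞ volume) (hW' : MemLp W ∞ volume) (hW0 : ∀ x, 0 ≤ W x)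
    {φ : Jet d} (hφ : IsFreeGroundState U φ) :
    freeEigenvalue U 2 - freeEigenvalue U 1 - ∫ x, W x * ‖φ.fst x‖ ^ 2 ≤
      eigenvalue U (fun x => W x - c) 2 - eigenvalue U (fun x => W x - c) 1 := by
  have h0 : MemLp (fun _ : Space d => (0 : ℝ)) ∞ volume := MemLp.zero
  obtain ⟨-, -, ψ₀, hp₀⟩ := exists_isLowestPair_formOp hd hU hb hne h0
  obtain ⟨-, -, ψ₁, hp₁⟩ := exists_isLowestPair_formOp hd hU hb hne hW
  have hquad : ∀ ψ : Jet d, quad (formOp hW) ψ =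
      quad (formOp h0) ψ + (∫ x, W x * ‖ψ.fst x‖ ^ 2) - c * ‖ψ.fst‖ ^ 2 := fun ψ => by
    rw [quad_formOp, quad_formOp, L2_norm_sq, ← integral_const_mul]
    simp only [sub_mul, zero_mul, integral_zero, add_zero]
    rw [integral_sub (integrable_mul_norm_sq hW' _)
      (((Lp.memLp ψ.fst).integrable_norm_pow (by norm_num)).const_mul c)]
    ring
  have hφ2 : quad (formOp h0) φ = freeEigenvalue U 1 := by
    rw [((isEigenfunction_iff h0 U _ φ).1 hφ.1).quad_eq, fstCLM_apply, hφ.2]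
    simp
  -- `φ` is a trial function for the perturbed operator.
  have hlow : eigenvalue U (fun x => W x - c) 1 ≤
      freeEigenvalue U 1 + (∫ x, W x * ‖φ.fst x‖ ^ 2) - c := by
    have := hp₁.le_quad φ hφ.1.1
    rw [hquad, hφ2, fstCLM_apply, hφ.2] at this
    linarith
  -- A combination of two low eigenvectors of the perturbed operator is orthogonal to the free
  -- minimiser `ψ₀`, so its free energy is at least the second free eigenvalue; `W ≥ 0` is dropped.
  have hhigh : freeEigenvalue U 2 - c ≤ eigenvalue U (fun x => W x - c) 2 := by
    obtain ⟨ψ, hψ, hz, horth, hq⟩ := exists_orthogonal_of_mem_formEigenvalueBounds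
      (isSymmetric_formOp hW) (coerciveOn_formOp hW _) hp₁.isLeast_two.1 (fstCLM d ψ₀)
    have h1 := hp₀.le_quad_of_orthogonal ψ hψ horth
    rw [hquad] at hq
    have h2 : 0 ≤ ∫ x, W x * ‖ψ.fst x‖ ^ 2 :=
      integral_nonneg fun x => mul_nonneg (hW0 x) (sq_nonneg _)
    have h3 : 0 < ‖ψ.fst‖ := norm_pos_iff.2 hz
    rw [fstCLM_apply] at h1 hq
    refine le_of_mul_le_mul_right ?_ (pow_pos h3 2)
    rw [sub_mul]
    change eigenvalue U (fun _ => 0) 2 * _ - _ ≤ _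
    linarith
  linarith

lemma freeEigenvalue_nonneg {U : Set (Space d)} {φ : Jet d} (hφ : IsFreeGroundState U φ) :
    0 ≤ freeEigenvalue U 1 := by
  have h0 : MemLp (fun _ : Space d => (0 : ℝ)) ∞ volume := MemLp.zero
  have h1 := ((isEigenfunction_iff h0 U _ φ).1 hφ.1).quad_eq
  rw [fstCLM_apply, hφ.2, quad_formOp] at h1
  simp only [zero_mul, integral_zero, add_zero, one_pow, mul_one] at h1
  rw [← h1]
  positivity

end Schrodinger

/-! ### The mean-field potential -/

section MeanField

open Filter Topology

variable {d : ℕ}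

/-- The convolution `|u|² * v`. -/
def density (v : Space d → ℝ) (u : Jet d) (x : Space d) : ℝ := ∫ y, ‖u.fst y‖ ^ 2 * v (x - y)

lemma integrable_norm_sq_fst (u : Jet d) : Integrable fun y => ‖u.fst y‖ ^ 2 :=
  (Lp.memLp u.fst).integrable_norm_pow (by norm_num)

lemma density_nonneg {v : Space d → ℝ} (hv : ∀ x, 0 ≤ v x) (u : Jet d) (x : Space d) :
    0 ≤ density v u x := integral_nonneg fun _ => mul_nonneg (sq_nonneg _) (hv _)

lemma integrable_density {v : Space d → ℝ} (hv : Integrable v) (u : Jet d) :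
    Integrable (density v u) :=
  (integrable_norm_sq_fst u).integrable_convolution (ContinuousLinearMap.mul ℝ ℝ) hv

lemma integral_density {v : Space d → ℝ} (hv : Integrable v) {u : Jet d} (hu : ‖u.fst‖ = 1) :
    ∫ x, density v u x = ∫ x, v x := by
  have h := integral_convolution (ContinuousLinearMap.mul ℝ ℝ) (μ := (volume : Measure (Space d)))
    (ν := (volume : Measure (Space d))) (integrable_norm_sq_fst u) hv
  rw [← L2_norm_sq, hu] at h
  rw [one_pow, ContinuousLinearMap.mul_apply', one_mul] at h
  exact h

lemma density_le {v : Space d → ℝ} (hv0 : ∀ x, 0 ≤ v x) {C : ℝ} (hC : ∀ᵐ x, v x ≤ C) {u : Jet d}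
    (hu : ‖u.fst‖ = 1) (x : Space d) : density v u x ≤ C := by
  have h1 : ∫ y, ‖u.fst y‖ ^ 2 * C = C := by
    rw [integral_mul_const, ← L2_norm_sq, hu]
    simp
  rw [← h1]
  refine integral_mono_of_nonneg (.of_forall fun y => mul_nonneg (sq_nonneg _) (hv0 _))
    ((integrable_norm_sq_fst u).mul_const C) ?_
  have h2 := (quasiMeasurePreserving_sub_left (volume : Measure (Space d)) x).ae hC
  filter_upwards [h2] with y hy
  gcongr

lemma memLp_density {v : Space d → ℝ} (hv : IsPairPotential v) {u : Jet d} (hu : ‖u.fst‖ = 1) :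
    MemLp (density v u) ∞ volume := by
  refine memLp_top_of_bound
    (integrable_density (memLp_one_iff_integrable.1 hv.memLp_one) u).aestronglyMeasurable
    (eLpNorm v ∞ volume).toReal (.of_forall fun x => ?_)
  rw [Real.norm_eq_abs, abs_of_nonneg (density_nonneg hv.nonneg u x)]
  refine density_le hv.nonneg ?_ hu x
  filter_upwards [ae_le_eLpNormEssSup (f := v) (μ := volume)] with y hy
  have h1 := (ENNReal.toReal_le_toReal (by simp) (by
    simpa using hv.memLp_top.2.ne)).2 hy
  rw [toReal_enorm] at h1
  rw [eLpNorm_exponent_top]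
  exact (le_abs_self _).trans h1

/-- Hölder with `density v u` in `L¹` and `φ` in `L^∞`; normalisation of `u` makes the `L¹` norm
that of `v`. -/
lemma integral_density_mul_le {v : Space d → ℝ} (hv : IsPairPotential v) {u φ : Jet d}
    (hu : ‖u.fst‖ = 1) {M : ℝ} (hM : ∀ᵐ x, ‖φ.fst x‖ ^ 2 ≤ M) :
    ∫ x, density v u x * ‖φ.fst x‖ ^ 2 ≤ (∫ x, ‖v x‖) * M := by
  have hvi := memLp_one_iff_integrable.1 hv.memLp_one
  have h1 : ∫ x, ‖v x‖ = ∫ x, density v u x := by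
    rw [integral_density hvi hu]
    congr 1 with x
    rw [Real.norm_eq_abs, abs_of_nonneg (hv.nonneg x)]
  rw [h1, ← integral_mul_const]
  refine integral_mono_of_nonneg (.of_forall fun x => mul_nonneg (density_nonneg hv.nonneg u x)
    (sq_nonneg _)) ((integrable_density hvi u).mul_const M) ?_
  filter_upwards [hM] with x hx
  exact mul_le_mul_of_nonneg_left hx (density_nonneg hv.nonneg u x)

end MeanField

/-! ### The vacancy set -/

section Vacancy

variable {d : ℕ}

lemma isBounded_box (ρ : ℝ) (N : ℕ) : Bornology.IsBounded (box d ρ N) := by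
  set L := ρ ^ (-(1 : ℝ) / d) * (N : ℝ) ^ ((1 : ℝ) / d)
  refine (Metric.isBounded_closedBall (x := (0 : Space d)) (r := √(∑ _i : Fin d, L ^ 2))).subset
    fun x hx => ?_
  rw [mem_closedBall_zero_iff, EuclideanSpace.norm_eq]
  refine Real.sqrt_le_sqrt (Finset.sum_le_sum fun i _ => ?_)
  have h := hx i
  rw [Real.norm_eq_abs, sq_abs]
  nlinarith [h.1, h.2]

lemma isOpen_box (ρ : ℝ) (N : ℕ) : IsOpen (box d ρ N) := by
  simp only [box, ofPred_forall]
  refine isOpen_iInter_of_finite fun i => ?_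
  have hi : Continuous fun x : Space d => x i := by fun_prop
  exact (isOpen_lt continuous_const hi).inter (isOpen_lt hi continuous_const)

/-- Balls of radius `r` meeting the unit ball around `x` have centres within `r + 1` of `x`, hence
are finitely many. The removed union is therefore locally finite and closed. -/
lemma isOpen_vacancySet {S : Set (Space d)}
    (hS : ∀ B : Set (Space d), Bornology.IsBounded B → (S ∩ B).Finite) (ρ r : ℝ) (N : ℕ) :
    IsOpen (vacancySet ρ r N S) := by
  refine (isOpen_box ρ N).sdiff ?_
  rw [biUnion_eq_iUnion]
  refine LocallyFinite.isClosed_iUnion (fun x => ?_) fun p => Metric.isClosed_closedBall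
  refine ⟨Metric.ball x 1, Metric.ball_mem_nhds x one_pos, ?_⟩
  have h1 := hS (Metric.closedBall x (r + 1)) Metric.isBounded_closedBall
  refine (h1.preimage (f := ((↑) : S → Space d)) Subtype.val_injective.injOn).subset ?_
  rintro p ⟨y, hy1, hy2⟩
  refine ⟨p.2, ?_⟩
  rw [Metric.mem_closedBall] at hy1 ⊢
  rw [Metric.mem_ball] at hy2
  have := dist_triangle_left (p : Space d) x y
  linarith

end Vacancy

/-- Here $C_1^2=4(4\pi)^{-d/2}\mathrm e^2$, so there is room to spare: only $\mathrm e\le 4\mathrm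
e^2$ is needed. -/
lemma groundState_bound_le (d : ℕ) {l : ℝ} (hl : 0 ≤ l) :
    (l / (4 * Real.pi)) ^ ((d : ℝ) / 2) * Real.exp 1 ≤ C₁ d ^ 2 * l ^ ((d : ℝ) / 2) := by
  have hπ := Real.pi_pos
  have h1 : ((4 * Real.pi) ^ (-(d : ℝ) / 4)) ^ 2 = ((4 * Real.pi) ^ ((d : ℝ) / 2))⁻¹ := by
    rw [← Real.rpow_natCast, ← Real.rpow_mul (by positivity), ← Real.rpow_neg (by positivity)]
    congr 1
    push_cast
    ring
  rw [C₁, mul_pow, mul_pow, h1, Real.div_rpow hl (by positivity)]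
  have h2 : 1 ≤ Real.exp 1 := Real.one_le_exp zero_le_one
  have h3 : 0 ≤ l ^ ((d : ℝ) / 2) * ((4 * Real.pi) ^ ((d : ℝ) / 2))⁻¹ := by positivity
  rw [div_eq_mul_inv]
  nlinarith [mul_nonneg h3 (by nlinarith : 0 ≤ 4 * Real.exp 1 ^ 2 - Real.exp 1)]

end KacLuttinger

end

/-! ### The gap inequality -/

open KacLuttinger
theorem mainTheorem5 {d : ℕ} (hd : 2 ≤ d)
    {Ω : Type*} [MeasurableSpace Ω] (P : Measure Ω) [IsProbabilityMeasure P]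
    (ρ ν r : ℝ) (hρ : 0 < ρ) (hν : 0 < ν) (hr : 0 < r)
    (X : Ω → Set (Space d)) (hX : IsPoissonPointProcess P X ν)
    (N : ℕ) (hN : 1 ≤ N) (v : Space d → ℝ) (hv : IsPairPotential v)
    (η : ℝ) (hη0 : 0 < η) (hη1 : η < vacancyFraction d ν r)
    (ω : Ω) (hω : ω ∈ eventTwo X ρ ν r v N η)
    (Λ : Set (Space d)) (hΛ : Λ = vacancySet ρ r N (X ω))
    (φ : Jet d) (hφ : IsFreeGroundState Λ φ)
    (K : Set (Space d)) (hK : IsComponent Λ K) (hφK : ∀ᵐ x, x ∉ K → φ.fst x = 0)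
    (u : Jet d) (hu : IsHartreeMinimizer K v N u) :
    (∀ k ∈ ({1, 2} : Set ℕ),
      HasEigenvalue Λ (fun _ => 0) k ∧ HasEigenvalue Λ (meanField Λ v N u) k) ∧
    eigenvalue Λ (meanField Λ v N u) 2 - eigenvalue Λ (meanField Λ v N u) 1 ≥
      freeEigenvalue Λ 2 - freeEigenvalue Λ 1 -
        C₁ d ^ 2 * N * (∫ x, ‖v x‖) * freeEigenvalue Λ 1 ^ ((d : ℝ) / 2) := by
  have hd0 : 0 < d := by omega
  have hΛo : IsOpen Λ := hΛ ▸ isOpen_vacancySet (hX.locallyFinite ω) ρ r N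
  have hΛb : Bornology.IsBounded Λ := hΛ ▸ (isBounded_box ρ N).subset sdiff_subset
  have hΛne : Λ.Nonempty := let ⟨x, hx, _⟩ := hK; ⟨x, hx⟩
  have hN1 : (0 : ℝ) ≤ (N : ℝ) - 1 := sub_nonneg.2 (by exact_mod_cast hN)
  set c := ((N : ℝ) - 1) / 2 * selfEnergy Λ v u with hc
  have hW' : MemLp (fun x => ((N : ℝ) - 1) * density v u x) ∞ volume :=
    (memLp_density hv hu.2.1).const_mul _
  have hW : MemLp (fun x => ((N : ℝ) - 1) * density v u x - c) ∞ volume :=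
    hW'.sub (memLp_top_const c)
  have hmf : meanField Λ v N u = fun x => ((N : ℝ) - 1) * density v u x - c := rfl
  have h0 : MemLp (fun _ : Space d => (0 : ℝ)) ∞ volume := MemLp.zero
  obtain ⟨hf1, hf2, -⟩ := exists_isLowestPair_formOp hd0 hΛo hΛb hΛne h0
  obtain ⟨hw1, hw2, -⟩ := exists_isLowestPair_formOp hd0 hΛo hΛb hΛne hW
  refine ⟨?_, ?_⟩
  · rintro k (rfl | rfl)
    · exact ⟨hf1, hw1⟩
    · exact ⟨hf2, hw2⟩
  have hgap := gap_comparison hd0 hΛo hΛb hΛne hW hW'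
    (fun x => mul_nonneg hN1 (density_nonneg hv.nonneg u x)) hφ
  rw [← hmf] at hgap
  set l := freeEigenvalue Λ 1 with hl
  have hl0 : 0 ≤ l := freeEigenvalue_nonneg hφ
  have hv0 : 0 ≤ ∫ x, ‖v x‖ := integral_nonneg fun x => norm_nonneg _
  have hint : ∫ x, ((N : ℝ) - 1) * density v u x * ‖φ.fst x‖ ^ 2 ≤
      ((N : ℝ) - 1) * ((∫ x, ‖v x‖) * ((l / (4 * Real.pi)) ^ ((d : ℝ) / 2) * Real.exp 1)) := by
    simp only [mul_assoc]
    rw [integral_const_mul]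
    refine mul_le_mul_of_nonneg_left ?_ hN1
    -- The sup bound requires `L > 0`. Letting `L` decrease to `l` avoids having to show `l > 0`.
    have h1 : Filter.Tendsto (fun L : ℝ => (∫ x, ‖v x‖) *
        ((L / (4 * Real.pi)) ^ ((d : ℝ) / 2) * Real.exp 1)) (nhdsWithin l (Ioi l))
        (nhds ((∫ x, ‖v x‖) * ((l / (4 * Real.pi)) ^ ((d : ℝ) / 2) * Real.exp 1))) := by
      refine Filter.Tendsto.mono_left ?_ nhdsWithin_le_nhds
      refine ((((continuous_id.div_const (4 * Real.pi)).rpow_const fun _ =>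
        Or.inr (by positivity)).mul_const _).const_mul _).tendsto l
    refine ge_of_tendsto h1 (eventually_mem_nhdsWithin.mono fun L hL => ?_)
    exact integral_density_mul_le hv hu.2.1
      (ae_norm_sq_le_of_isEigenfunction hΛb hl0 (mem_Ioi.1 hL).le (hl0.trans_lt hL) hφ.1 hφ.2)
  have hbound : ((N : ℝ) - 1) * ((∫ x, ‖v x‖) *
      ((l / (4 * Real.pi)) ^ ((d : ℝ) / 2) * Real.exp 1)) ≤
      C₁ d ^ 2 * N * (∫ x, ‖v x‖) * l ^ ((d : ℝ) / 2) := by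
    have h1 := groundState_bound_le d hl0
    calc _ ≤ (N : ℝ) * ((∫ x, ‖v x‖) * (C₁ d ^ 2 * l ^ ((d : ℝ) / 2))) := by
          gcongr
          linarith
      _ = _ := by ring
  linarith
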